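/- Let $D,m>0$ be real numbers with $2+\tfrac m2<D+m<4+\tfrac m2$, let $p,q>0$, and put $$d=D+m,\quad \epsilon=D-2+\tfrac m2\in(0,2),\quad a=2-\epsilon=4-D-\tfrac m2,\quad b=\tfrac{3-D}2,\quad X=\frac{4p^2}{q^4},\quad \zeta=\frac{X}{1+X}.$$ Let $$I_{D,m}(p,q)=\int\frac{d^mq'}{(2\pi)^m}\int\frac{d^Dp'}{(2\pi)^D}\,\frac1{p'^2+q'^4}\,\frac1{|\boldsymbol p'+\boldsymbol p|^2+|\boldsymbol q'+\boldsymbol q|^4},\qquad |\boldsymbol p|=p,\ |\boldsymbol q|=q.$$ Here, for an arbitrary real dimension $D>0$, the integral of a function $f(u,s)$ of the coordinate $u$ along the axis of the external momentum and of the squared distance $s$ from this axis is $$\int d^Dk\, f=\int_{-\infty}^{\infty}du\;\frac{-\pi^{(D-1)/2}}{\Gamma(\frac{D+1}2)}\int_0^\infty s^{(D-1)/2}\,\partial_sf(u,s)\,ds,$$ which is the analytic continuation in $D$ of the ordinary integral (for $D>1$ it is the integral in cylindrical coordinates, after one integration by parts); likewise for $m$. Set $$A_{D,m}=\frac{8}{(16\pi)^{(d-1)/2}}\frac{\Gamma(2-\epsilon)}{\Gamma(\frac{5-D}2)},\qquad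 C_r=\frac{(a)_{2r}4^{-r}}{(\frac32)_r(b+1)_r},\qquad F_r={}_3F_2\!\left({a+2r,\ \tfrac12,\ b\atop \tfrac32+r,\ b+1+r};1\right),$$ where $(x)_n=x(x+1)\cdots(x+n-1)$ and ${}_3F_2$ is the generalised hypergeometric series. Then the series defining each $F_r$ converges, and $$I_{D,m}(p,q)=\frac{A_{D,m}\,q^{-4+2\epsilon}}{(1+X)^{a/2}}\sum_{k=0}^\infty\frac{(\frac a2)_k}{k!}\,\Upsilon_k\,\zeta^k,\qquad \Upsilon_k=\sum_{r=0}^k(-k)_r\,\frac{C_rF_r}{(\frac a2)_r},$$ the series over $k$ being convergent. When $D$ and $m$ are integers, the integrand is Lebesgue integrable over $\mathbb R^m\times\mathbb R^D$ and $I_{D,m}(p,q)$ is the ordinary Lebesgue integral. -/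

import Mathlib

open MeasureTheory

noncomputable section

namespace Lifshitz

/-- Integration over Euclidean space of real dimension `D > 0` of a function with rotational
symmetry about an axis, written as `f u s`, where `u` is the coordinate along the axis and `s` the
squared distance from the axis.

For `D > 1` the integral over the `(D - 1)`-dimensional transverse space of a function `g` of `s` is
`π ^ ((D - 1) / 2) / Γ((D - 1) / 2) * ∫ s in (0, ∞), s ^ ((D - 1) / 2 - 1) * g s`.
One integration by parts turns this into the expression below, which makes sense
for every `D > 0` and so gives the analytic continuation in `D`; for `D = 1` the transverse
part is `g 0`. -/
def dimIntegral (D : ℝ) (f : ℝ → ℝ → ℝ) : ℝ :=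
  ∫ u : ℝ, -(Real.pi ^ ((D - 1) / 2) / Real.Gamma ((D + 1) / 2)) *
    ∫ s in Set.Ioi (0 : ℝ), s ^ ((D - 1) / 2) * deriv (f u) s

/-- The `D`-dimensional one-loop two-point integral with external momentum of length `p`
and masses `m₁`, `m₂`:
`∫ d^D p' / (2π)^D 1 / (p'^2 + m₁^2) 1 / (|p' + p|^2 + m₂^2)`. -/
def innerIntegral (D p m₁ m₂ : ℝ) : ℝ :=
  dimIntegral D fun u s =>
    1 / (2 * Real.pi) ^ D * (1 / (u ^ 2 + s + m₁ ^ 2)) * (1 / ((u + p) ^ 2 + s + m₂ ^ 2))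

/-- The integral `I_{D,m}(p,q)` for real dimensions `D`, `m`, as a function of the lengths
`p`, `q` of the external momenta: the `m`-dimensional integral over `q'` of the inner integral
with masses `|q'|^2` and `|q' + q|^2`. -/
def feynman (D m p q : ℝ) : ℝ :=
  dimIntegral m fun v t =>
    1 / (2 * Real.pi) ^ m * innerIntegral D p (v ^ 2 + t) ((v + q) ^ 2 + t)

/-- The integrand of the Feynman integral in integer dimensions `D`, `m`,
with the factors `1 / (2π)^m` and `1 / (2π)^D` included. -/
def feynmanIntegrand {D m : ℕ} (p : EuclideanSpace ℝ (Fin D)) (q : EuclideanSpace ℝ (Fin m))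
    (q' : EuclideanSpace ℝ (Fin m)) (p' : EuclideanSpace ℝ (Fin D)) : ℝ :=
  1 / (2 * Real.pi) ^ m * (1 / (2 * Real.pi) ^ D) *
    (1 / (‖p'‖ ^ 2 + ‖q'‖ ^ 4)) * (1 / (‖p' + p‖ ^ 2 + ‖q' + q‖ ^ 4))

/-- The Pochhammer symbol `(x)_n = x (x + 1) ⋯ (x + n - 1)`. -/
def poch (x : ℝ) (n : ℕ) : ℝ := (ascPochhammer ℝ n).eval x

/-- The `n`-th term of the series of the generalised hypergeometric function
`₃F₂(a₁, a₂, a₃; b₁, b₂; z)`. -/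
def hyp32Term (a₁ a₂ a₃ b₁ b₂ z : ℝ) (n : ℕ) : ℝ :=
  poch a₁ n * poch a₂ n * poch a₃ n / (poch b₁ n * poch b₂ n) * (z ^ n / (n.factorial : ℝ))

/-- The generalised hypergeometric function `₃F₂(a₁, a₂, a₃; b₁, b₂; z)`. -/
def hyp32 (a₁ a₂ a₃ b₁ b₂ z : ℝ) : ℝ := ∑' n : ℕ, hyp32Term a₁ a₂ a₃ b₁ b₂ z n

/-- `ε = D - 2 + m / 2`. -/
def eps (D m : ℝ) : ℝ := D - 2 + m / 2

/-- `a = 4 - D - m / 2 = 2 - ε`. -/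
def parA (D m : ℝ) : ℝ := 4 - D - m / 2

/-- `b = (3 - D) / 2`. -/
def parB (D : ℝ) : ℝ := (3 - D) / 2

/-- `A_{D,m} = 8 (16π)^{-(d - 1) / 2} Γ(2 - ε) / Γ((5 - D) / 2)` with `d = D + m`. -/
def coeffA (D m : ℝ) : ℝ :=
  8 / (16 * Real.pi) ^ ((D + m - 1) / 2) *
    (Real.Gamma (2 - eps D m) / Real.Gamma ((5 - D) / 2))

/-- `C_k = (a)_{2k} 4^{-k} / ((3/2)_k (b + 1)_k)`. -/
def coeffC (D m : ℝ) (k : ℕ) : ℝ :=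
  poch (parA D m) (2 * k) / 4 ^ k / (poch (3 / 2) k * poch (parB D + 1) k)

/-- `F_k = ₃F₂(a + 2k, 1/2, b; 3/2 + k, b + 1 + k; 1)`. -/
def coeffF (D m : ℝ) (k : ℕ) : ℝ :=
  hyp32 (parA D m + 2 * k) (1 / 2) (parB D) (3 / 2 + k) (parB D + 1 + k) 1

/-- `Υ_k = ∑_{r = 0}^k (-k)_r C_r F_r / (a / 2)_r`. -/
def upsilon (D m : ℝ) (k : ℕ) : ℝ :=
  ∑ r ∈ Finset.range (k + 1),
    poch (-(k : ℝ)) r * (coeffC D m r * coeffF D m r / poch (parA D m / 2) r)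

/-- `X = 4 p^2 / q^4`. -/
def parX (p q : ℝ) : ℝ := 4 * p ^ 2 / q ^ 4

/-- `ζ = X / (1 + X)`. -/
def zeta (p q : ℝ) : ℝ := parX p q / (1 + parX p q)

end Lifshitz

end

namespace Lifshitz

open Filter Asymptotics Topology
open Finset.HasAntidiagonal (antidiagonal mem_antidiagonal)

/-! ### Pochhammer symbols -/

/-! Write c = 2 - D/2. Feynman parametrisation with a parameter y ∈ [-1, 1] turns the inner integral
into a multiple of ∫ Δ(y)^(-c) dy (`innerIntegral_eq`). In the outer integral the axis coordinate v
is shifted by q/2. With S = v² + t + q²/4 and w = vq the masses become S - w and S + w, and Δ = M (1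
+ Xτ), where M = S² + w² + 2ySw and τ = (1 - y²) q⁴ / (16 M). As S ≥ q²/4, τ lies in [0, 1]
(`tauVar_mem`). The derivative in t defining the outer integral gives I = const · ∫ W (1 +
Xτ)^(-(c+1)), with a nonnegative weight W that does not involve p (`feynman_eq_integral`).

All the information is then in the moments ∫ W τ^r. Up to a constant and a power of t, W τ^r is the
S-derivative, at fixed w, of (1 - y²)^r M^(-(c+r)). Its integral over y is a series of Gegenbauer
type in the monomials w^(2n) S^(-2(c+r)-2n); reaching this form takes a quadratic transformation of
₂F₁ (`hyp21_quadratic`, `hasSum_integral_gegenbauer_deriv`). Each differentiated monomial integrates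
over (v, t) to a quotient of Gamma functions by two beta integrals, and the sum over n is a ₃F₂ at
1. The outcome is (c+1)_r / r! · ∫ W τ^r = N C_r F_r with N independent of r
(`integral_momentKernel`, `integral_tauVar_pow`). The condition a > 0 makes every term integrable; a
< 2 makes the series over n converge.

A direct expansion in X would not cover large X. Instead 1 + Xτ = (1 + X)(1 - ζ(1 - τ)) and 1 - ζ =
1/(1 + X), so (1 + X)^(a/2) (1 + Xτ)^(-(c+1)) is a product of two binomial series in ζ < 1,
dominated uniformly in τ ∈ [0, 1]. Chu–Vandermonde collects the powers of τ (`resumCoeff_eq`), and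
termwise integration produces Υ_k (`hasSum_resummed_integral`, `poch_mul_upsilon`).

In integer dimensions everything is nonnegative. Tonelli, a splitting along the external momentum
and the layer-cake formula with the volume of balls identify `dimIntegral` with the Lebesgue
integral (`lintegral_eq_dimIntegral`), first for the bubble and then for the outer integral. -/

@[simp] lemma poch_zero (x : ℝ) : poch x 0 = 1 := by simp [poch]

lemma poch_succ (x : ℝ) (n : ℕ) : poch x (n + 1) = poch x n * (x + n) := by
  simp [poch, ascPochhammer_succ_eval]

lemma poch_succ_left (x : ℝ) (n : ℕ) : poch x (n + 1) = x * poch (x + 1) n := by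
  induction n with
  | zero => simp [poch_succ]
  | succ n ih => rw [poch_succ, ih, poch_succ]; push_cast; ring

lemma poch_add (x : ℝ) (m n : ℕ) : poch x (m + n) = poch x m * poch (x + m) n := by
  induction n with
  | zero => simp
  | succ n ih => rw [← add_assoc, poch_succ, ih, poch_succ]; push_cast; ring

lemma poch_pos {x : ℝ} (hx : 0 < x) (n : ℕ) : 0 < poch x n := ascPochhammer_pos n x hx

lemma poch_ne_zero {x : ℝ} (hx : 0 < x) (n : ℕ) : poch x n ≠ 0 := (poch_pos hx n).ne'

lemma poch_one (n : ℕ) : poch 1 n = n.factorial := by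
  induction n with
  | zero => simp
  | succ n ih => rw [poch_succ, ih, Nat.factorial_succ]; push_cast; ring

/-- Duplication of the Pochhammer symbol. -/
lemma poch_two_mul (x : ℝ) (n : ℕ) :
    poch (2 * x) (2 * n) = 4 ^ n * poch x n * poch (x + 1 / 2) n := by
  induction n with
  | zero => simp
  | succ n ih =>
    rw [show 2 * (n + 1) = 2 * n + 1 + 1 by ring, poch_succ, poch_succ, ih, poch_succ, poch_succ]
    push_cast; ring

lemma factorial_two_mul (n : ℕ) :
    ((2 * n).factorial : ℝ) = 4 ^ n * poch (1 / 2) n * n.factorial := by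
  have := poch_two_mul (1 / 2) n
  rw [show (2 : ℝ) * (1 / 2) = 1 by norm_num, show (1 / 2 : ℝ) + 1 / 2 = 1 by norm_num, poch_one,
    poch_one] at this
  exact this

lemma Gamma_add_nat {x : ℝ} (hx : 0 < x) (n : ℕ) :
    Real.Gamma (x + n) = poch x n * Real.Gamma x := by
  induction n with
  | zero => simp
  | succ n ih =>
    rw [Nat.cast_succ, ← add_assoc, Real.Gamma_add_one (by positivity), ih, poch_succ]; ring

lemma poch_reflect (x : ℝ) (n : ℕ) : poch x n = (-1) ^ n * poch (1 - x - n) n := by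
  induction n generalizing x with
  | zero => simp
  | succ n ih =>
    rw [poch_succ, ih, poch_succ_left]
    push_cast
    rw [show 1 - x - ((n : ℝ) + 1) + 1 = 1 - x - n by ring]
    ring

/-- `(-k)_r / k! = (-1)^r / (k - r)!`. -/
lemma poch_neg_nat {k r : ℕ} (h : r ≤ k) :
    poch (-(k : ℝ)) r = (-1) ^ r * k.factorial / (k - r).factorial := by
  induction r with
  | zero => simp [Nat.factorial_ne_zero]
  | succ r ih =>
    rw [poch_succ, ih (by omega), show k - r = (k - (r + 1)) + 1 by omega, Nat.factorial_succ]
    have : ((k - (r + 1) : ℕ) : ℝ) = k - (r + 1) := by push_cast [Nat.cast_sub h]; ring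
    have h0 : ((k - (r + 1) : ℕ) : ℝ) + 1 ≠ 0 := by positivity
    have h1 : ((k - (r + 1)).factorial : ℝ) ≠ 0 := by positivity
    push_cast
    field_simp
    rw [this]; ring

/-- The Chu–Vandermonde identity. -/
lemma sum_choose_poch (x y : ℝ) (n : ℕ) :
    ∑ ij ∈ antidiagonal n, (n.choose ij.1 : ℝ) * (poch x ij.1 * poch y ij.2) =
      poch (x + y) n := by
  induction n with
  | zero => simp
  | succ n ih =>
    rw [Finset.sum_antidiagonal_choose_succ_mul (fun i j => poch x i * poch y j), poch_succ, ← ih,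
      Finset.sum_mul, ← Finset.sum_add_distrib]
    refine Finset.sum_congr rfl fun ij hij => ?_
    have h := mem_antidiagonal.1 hij
    rw [show n.choose ij.2 = n.choose ij.1 from by
      rw [← h, Nat.choose_symm_add], poch_succ, poch_succ, ← h]
    push_cast; ring

lemma sum_poch_div (x y : ℝ) (n : ℕ) :
    ∑ ij ∈ antidiagonal n,
      poch x ij.1 / (ij.1.factorial : ℝ) * (poch y ij.2 / (ij.2.factorial : ℝ)) =
      poch (x + y) n / n.factorial := by
  rw [← sum_choose_poch, Finset.sum_div]
  refine Finset.sum_congr rfl fun ij hij => ?_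
  have h := mem_antidiagonal.1 hij
  have := Nat.add_choose_mul_factorial_mul_factorial ij.1 ij.2
  rw [h, show n.choose ij.2 = n.choose ij.1 from by rw [← h, Nat.choose_symm_add]] at this
  rw [← this]
  have h1 : (ij.1.factorial : ℝ) ≠ 0 := by positivity
  have h2 : (ij.2.factorial : ℝ) ≠ 0 := by positivity
  have h3 : (n.choose ij.1 : ℝ) ≠ 0 := by
    exact_mod_cast (Nat.choose_pos (by omega)).ne'
  push_cast
  field_simp

/-- The binomial series. -/
lemma hasSum_poch_binomial (α : ℝ) {x : ℝ} (hx : |x| < 1) :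
    HasSum (fun n : ℕ => poch α n / n.factorial * x ^ n) ((1 - x) ^ (-α)) := by
  have h := Real.one_div_one_sub_rpow_hasFPowerSeriesOnBall_zero α
  have hb : x ∈ Metric.eball (0 : ℝ) 1 := by
    rw [mem_eball_zero_iff, ← ofReal_norm, Real.norm_eq_abs]
    simpa using ENNReal.ofReal_lt_one.2 hx
  have h1 := h.hasSum hb
  simp only [zero_add, one_div] at h1
  rw [Real.rpow_neg (by linarith [(abs_lt.1 hx).2])]
  have h2 : ∀ n : ℕ, (FormalMultilinearSeries.ofScalars ℝ
      (fun n : ℕ => Ring.choose (α + n - 1) n) n) (fun _ => x) =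
      poch α n / n.factorial * x ^ n := by
    intro n
    rw [FormalMultilinearSeries.ofScalars_apply_eq, ← Ring.multichoose_eq, smul_eq_mul]
    congr 1
    have := Ring.factorial_nsmul_multichoose_eq_ascPochhammer α n
    rw [Polynomial.ascPochhammer_smeval_eq_eval, nsmul_eq_mul] at this
    rw [eq_div_iff (by positivity), mul_comm, this, poch]
  simpa only [h2] using h1

/-! ### Growth of Pochhammer symbols and convergence of hypergeometric series -/

/-- `(x)_n` grows like `n^{x-1} n!`. -/
lemma poch_isTheta {x : ℝ} (hx : 0 < x) :
    (fun n : ℕ => poch x n) =Θ[atTop] fun n : ℕ => (n : ℝ) ^ (x - 1) * n.factorial := by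
  have hlim : Tendsto (fun n : ℕ => poch x n / ((n : ℝ) ^ (x - 1) * n.factorial)) atTop
      (𝓝 (1 * (Real.Gamma x)⁻¹)) := by
    have h1 := (Real.GammaSeq_tendsto_Gamma x).inv₀ (Real.Gamma_pos_of_pos hx).ne'
    have h2 : Tendsto (fun n : ℕ => (n : ℝ) / (n + x)) atTop (𝓝 1) :=
      tendsto_natCast_div_add_atTop x
    refine (h2.mul h1).congr' ?_
    filter_upwards [eventually_gt_atTop 0] with n hn
    have hn' : (0 : ℝ) < n := by exact_mod_cast hn
    have hp : ∏ j ∈ Finset.range (n + 1), (x + j) = poch x n * (x + n) := by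
      rw [← poch_succ]
      generalize n + 1 = k
      induction k with
      | zero => simp
      | succ k ih => rw [Finset.prod_range_succ, ih, poch_succ]
    rw [Real.GammaSeq, hp, Real.rpow_sub_one hn'.ne']
    have := poch_pos hx n
    have : 0 < (n : ℝ) ^ x := by positivity
    have : 0 < x + n := by positivity
    field_simp
    ring
  refine (isTheta_of_div_tendsto_nhds_ne_zero hlim ?_).symm
  simpa using (Real.Gamma_pos_of_pos hx).ne'

lemma poch_eq_div {b : ℝ} (n : ℕ) : poch b n * (b + n) = b * poch (b + 1) n := by
  rw [← poch_succ, poch_succ_left]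

lemma div_add_natCast_isBigO (b : ℝ) :
    (fun n : ℕ => b / (b + n)) =O[atTop] fun n : ℕ => (n : ℝ)⁻¹ := by
  have h1 : Tendsto (fun n : ℕ => (n : ℝ) / (n + b)) atTop (𝓝 1) := tendsto_natCast_div_add_atTop b
  have h2 : (fun n : ℕ => b * ((n : ℝ)⁻¹ * ((n : ℝ) / (n + b)))) =O[atTop]
      fun n : ℕ => (n : ℝ)⁻¹ := by
    simpa using ((isBigO_refl (fun n : ℕ => (n : ℝ)⁻¹) atTop).mul (h1.isBigO_one ℝ)).const_mul_left b
  refine h2.congr' ?_ EventuallyEq.rfl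
  filter_upwards [eventually_gt_atTop 0] with n hn
  have hn' : (n : ℝ) ≠ 0 := by exact_mod_cast hn.ne'
  rw [add_comm b]
  field_simp

/-- Extends the upper bound to -1 < b, which is needed because (3 - D)/2 is negative for D > 3. The
shift b (b+1)_n = (b)_n (b + n) reduces it to a positive parameter. Only an upper bound survives,
since (b)_n vanishes for n ≥ 1 when b = 0. -/
lemma poch_isBigO {b : ℝ} (hb : 0 < b + 1) :
    (fun n : ℕ => poch b n) =O[atTop] fun n : ℕ => (n : ℝ) ^ (b - 1) * n.factorial := by
  have h := (div_add_natCast_isBigO b).mul (poch_isTheta hb).isBigO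
  refine h.congr' ?_ ?_
  · filter_upwards [eventually_gt_atTop 0] with n hn
    have hn' : (1 : ℝ) ≤ n := by exact_mod_cast hn
    have : b + n ≠ 0 := by linarith
    rw [div_mul_eq_mul_div, ← poch_eq_div]
    field_simp
  · filter_upwards [eventually_gt_atTop 0] with n hn
    have hn' : (n : ℝ) ≠ 0 := by exact_mod_cast hn.ne'
    rw [add_sub_cancel_right, Real.rpow_sub_one hn']
    ring

lemma poch_inv_isBigO {x : ℝ} (hx : 0 < x) :
    (fun n : ℕ => (poch x n)⁻¹) =O[atTop] fun n : ℕ => ((n : ℝ) ^ (x - 1) * n.factorial)⁻¹ :=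
  (poch_isTheta hx).inv.isBigO

/-- The factorials cancel and the terms are O(n^(a₁ + a₂ + b - b₁ - b₂ - 1)), so a positive
parametric excess suffices. -/
lemma hyp32Term_one_summable {a₁ a₂ b b₁ b₂ : ℝ} (ha₁ : 0 < a₁) (ha₂ : 0 < a₂) (hb : 0 < b + 1)
    (hb₁ : 0 < b₁) (hb₂ : 0 < b₂) (h : a₁ + a₂ + b < b₁ + b₂) :
    Summable (hyp32Term a₁ a₂ b b₁ b₂ 1) := by
  have h1 := ((((poch_isTheta ha₁).isBigO.mul (poch_isTheta ha₂).isBigO).mul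
    (poch_isBigO hb)).mul ((poch_inv_isBigO hb₁).mul (poch_inv_isBigO hb₂))).mul
    (isBigO_refl (fun n : ℕ => (n.factorial : ℝ)⁻¹) atTop)
  refine summable_of_isBigO_nat (Real.summable_nat_rpow.2
    (show a₁ + a₂ + b - b₁ - b₂ - 1 < -1 by linarith)) (h1.congr' ?_ ?_)
  · refine Eventually.of_forall fun n => ?_
    simp only [hyp32Term, div_eq_mul_inv, mul_inv, one_pow, one_mul]
  · filter_upwards [eventually_gt_atTop 0] with n hn
    have hn' : (0 : ℝ) < n := by exact_mod_cast hn
    have hf : (n.factorial : ℝ) ≠ 0 := by positivity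
    rw [show a₁ + a₂ + b - b₁ - b₂ - 1 = (a₁ - 1) + (a₂ - 1) + (b - 1) - (b₁ - 1) - (b₂ - 1)
      by ring, Real.rpow_sub hn' (_ - _), Real.rpow_sub hn' (_ + _), Real.rpow_add hn' (_ + _),
      Real.rpow_add hn' (a₁ - 1)]
    have h1 : 0 < (n : ℝ) ^ (b₁ - 1) := by positivity
    have h2 : 0 < (n : ℝ) ^ (b₂ - 1) := by positivity
    field_simp

/-- The coefficients of `₂F₁(x, b; y; ·)`. -/
noncomputable def hyp21Coeff (x b y : ℝ) (n : ℕ) : ℝ := poch x n * poch b n / (poch y n * n.factorial)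

/-- The extra factor n^j serves termwise differentiation, where j = 1 occurs. -/
lemma hyp21Coeff_summable {x b y ρ : ℝ} (hx : 0 < x) (hb : 0 < b + 1) (hy : 0 < y)
    (hρ : |ρ| < 1) (j : ℕ) :
    Summable fun n : ℕ => (n : ℝ) ^ j * (hyp21Coeff x b y n * ρ ^ n) := by
  -- The coefficients are O(n^(x+b-y-1)), hence O(n^N), which leaves a polynomial times a geometric
  -- series.
  obtain ⟨N, hN⟩ := exists_nat_ge (x + b - y - 1)
  have h1 := (((poch_isTheta hx).isBigO.mul (poch_isBigO hb)).mul (poch_inv_isBigO hy)).mul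
    (isBigO_refl (fun n : ℕ => (n.factorial : ℝ)⁻¹ * ((n : ℝ) ^ j * ρ ^ n)) atTop)
  refine summable_of_isBigO_nat (summable_pow_mul_geometric_of_norm_lt_one (N + j) hρ)
    (IsBigO.trans (h1.congr' (Eventually.of_forall fun n => ?_) EventuallyEq.rfl)
      (IsBigO.of_bound 1 ?_))
  · simp only [hyp21Coeff, div_eq_mul_inv, mul_inv]; ring
  · filter_upwards [eventually_gt_atTop 0] with n hn
    have hn' : (1 : ℝ) ≤ n := by exact_mod_cast hn
    have hn0 : (0 : ℝ) < n := by linarith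
    have hf : (n.factorial : ℝ) ≠ 0 := by positivity
    have e : (n : ℝ) ^ (x - 1) * n.factorial * ((n : ℝ) ^ (b - 1) * n.factorial) *
        ((n : ℝ) ^ (y - 1) * n.factorial)⁻¹ * ((n.factorial : ℝ)⁻¹ * ((n : ℝ) ^ j * ρ ^ n)) =
        (n : ℝ) ^ (x + b - y - 1) * ((n : ℝ) ^ j * ρ ^ n) := by
      rw [show x + b - y - 1 = (x - 1) + (b - 1) - (y - 1) by ring, Real.rpow_sub hn0 (_ + _),
        Real.rpow_add hn0 (x - 1)]
      have h1 : 0 < (n : ℝ) ^ (y - 1) := by positivity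
      field_simp
    rw [e, pow_add, one_mul, mul_assoc, norm_mul _ ((n : ℝ) ^ j * ρ ^ n),
      norm_mul _ ((n : ℝ) ^ j * ρ ^ n)]
    gcongr
    rw [Real.norm_of_nonneg (by positivity), Real.norm_of_nonneg (by positivity),
      ← Real.rpow_natCast]
    exact Real.rpow_le_rpow_of_exponent_le hn' hN

end Lifshitz

/-! ### Beta integrals and the moments of (1 - y²)^r -/

namespace Lifshitz

open Set

/-- The kernel behind the beta integral: the y-integral gives Γ(β) s^(α-1) (L+s)^(-β), and the
s-integral gives Γ(α) times a Gamma integrand of exponent β - α, integrable because α < β. Fubini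
compares the two orders. -/
lemma integrable_gamma_kernel {α β L : ℝ} (hα : 0 < α) (hβ : α < β) (hL : 0 < L) :
    Integrable (Function.uncurry fun s y : ℝ =>
        s ^ (α - 1) * (y ^ (β - 1) * Real.exp (-((L + s) * y))))
      ((volume.restrict (Ioi 0)).prod (volume.restrict (Ioi 0))) ∧
    ∀ y ∈ Ioi (0 : ℝ), ∫ s in Ioi (0 : ℝ), s ^ (α - 1) * (y ^ (β - 1) * Real.exp (-((L + s) * y))) =
      Real.Gamma α * (y ^ (β - α - 1) * Real.exp (-(L * y))) := by
  have key : ∀ y ∈ Ioi (0 : ℝ), ∀ s : ℝ,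
      s ^ (α - 1) * (y ^ (β - 1) * Real.exp (-((L + s) * y))) =
      y ^ (β - 1) * Real.exp (-(L * y)) * (s ^ (α - 1) * Real.exp (-(y * s))) := by
    intro y hy s
    rw [show -((L + s) * y) = -(L * y) + -(y * s) by ring, Real.exp_add]; ring
  have hint : ∀ y ∈ Ioi (0 : ℝ),
      ∫ s in Ioi (0 : ℝ), s ^ (α - 1) * (y ^ (β - 1) * Real.exp (-((L + s) * y))) =
      Real.Gamma α * (y ^ (β - α - 1) * Real.exp (-(L * y))) := by
    intro y hy
    have hy' : 0 < y := hy
    simp_rw [key y hy]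
    rw [integral_const_mul, Real.integral_rpow_mul_exp_neg_mul_Ioi hα hy, one_div,
      Real.inv_rpow hy'.le, show β - α - 1 = β - 1 - α by ring, Real.rpow_sub hy' (β - 1)]
    rw [Real.rpow_sub_one hy'.ne', ← mul_assoc, mul_comm (_ * _) (Real.Gamma α)]
    ring
  refine ⟨?_, hint⟩
  rw [integrable_prod_iff']
  · constructor
    · filter_upwards [ae_restrict_mem measurableSet_Ioi] with y hy
      simp only [Function.uncurry, key y hy]
      refine Integrable.const_mul ?_ _
      have := Real.GammaIntegral_convergent hα
      have hy' : 0 < y := hy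
      have h2 := (integrableOn_Ioi_comp_mul_left_iff
        (fun x => Real.exp (-x) * x ^ (α - 1)) 0 hy').2 (by simpa using this)
      refine (h2.const_mul (y ^ (1 - α))).congr ?_
      filter_upwards [ae_restrict_mem measurableSet_Ioi] with s hs
      have hs' : 0 < s := hs
      rw [Real.mul_rpow hy'.le hs'.le, show 1 - α = -(α - 1) by ring, Real.rpow_neg hy'.le]
      have := Real.rpow_pos_of_pos hy' (α - 1)
      field_simp
    · have h : Integrable (fun y : ℝ => Real.Gamma α * (y ^ (β - α - 1) * Real.exp (-(L * y))))
          (volume.restrict (Ioi 0)) := by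
        refine Integrable.const_mul ?_ _
        have := Real.GammaIntegral_convergent (sub_pos.2 hβ)
        have h2 := (integrableOn_Ioi_comp_mul_left_iff
          (fun x => Real.exp (-x) * x ^ (β - α - 1)) 0 hL).2 (by simpa using this)
        refine (h2.const_mul (L ^ (1 - (β - α)))).congr ?_
        filter_upwards [ae_restrict_mem measurableSet_Ioi] with s hs
        have hs' : 0 < s := hs
        rw [Real.mul_rpow hL.le hs'.le, show 1 - (β - α) = -(β - α - 1) by ring,
          Real.rpow_neg hL.le]
        have := Real.rpow_pos_of_pos hL (β - α - 1)
        field_simp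
      refine h.congr ?_
      filter_upwards [ae_restrict_mem measurableSet_Ioi] with y hy
      rw [← hint y hy]
      refine setIntegral_congr_fun measurableSet_Ioi fun s hs => ?_
      have hs' : 0 < s := hs
      have hy' : 0 < y := hy
      simp only [Function.uncurry]
      rw [Real.norm_of_nonneg (by positivity)]
  · refine Measurable.aestronglyMeasurable ?_
    unfold Function.uncurry
    fun_prop

lemma integral_rpow_mul_exp_add {β L s : ℝ} (hβ : 0 < β) (hL : 0 < L) (hs : 0 < s) (α : ℝ) :
    ∫ y in Ioi (0 : ℝ), s ^ (α - 1) * (y ^ (β - 1) * Real.exp (-((L + s) * y))) =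
      Real.Gamma β * (s ^ (α - 1) * (L + s) ^ (-β)) := by
  have hLs : 0 < L + s := by positivity
  rw [integral_const_mul, Real.integral_rpow_mul_exp_neg_mul_Ioi hβ hLs, one_div,
    Real.inv_rpow hLs.le, Real.rpow_neg hLs.le]
  ring

/-- Euler's beta integral over the half line. -/
lemma integrableOn_rpow_mul_add_rpow {α β L : ℝ} (hα : 0 < α) (hβ : α < β) (hL : 0 < L) :
    IntegrableOn (fun s : ℝ => s ^ (α - 1) * (L + s) ^ (-β)) (Ioi 0) := by
  have h := (integrable_gamma_kernel hα hβ hL).1.integral_prod_left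
  have hG := Real.Gamma_pos_of_pos (hα.trans hβ)
  refine (h.const_mul (Real.Gamma β)⁻¹).congr ?_
  filter_upwards [ae_restrict_mem measurableSet_Ioi] with s hs
  simp only [Function.uncurry]
  rw [integral_rpow_mul_exp_add (hα.trans hβ) hL hs, inv_mul_cancel_left₀ hG.ne']

lemma integral_rpow_mul_add_rpow {α β L : ℝ} (hα : 0 < α) (hβ : α < β) (hL : 0 < L) :
    ∫ s in Ioi (0 : ℝ), s ^ (α - 1) * (L + s) ^ (-β) =
      L ^ (α - β) * (Real.Gamma α * Real.Gamma (β - α) / Real.Gamma β) := by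
  have h := integral_integral_swap (integrable_gamma_kernel hα hβ hL).1
  have hG := Real.Gamma_pos_of_pos (hα.trans hβ)
  rw [setIntegral_congr_fun measurableSet_Ioi (fun s hs =>
      integral_rpow_mul_exp_add (hα.trans hβ) hL hs α),
    setIntegral_congr_fun measurableSet_Ioi (integrable_gamma_kernel hα hβ hL).2,
    integral_const_mul, integral_const_mul,
    Real.integral_rpow_mul_exp_neg_mul_Ioi (sub_pos.2 hβ) hL, one_div, Real.inv_rpow hL.le,
    ← Real.rpow_neg hL.le] at h
  rw [← neg_sub β α]
  field_simp
  linarith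

/-- The substitution s = v² in the beta integral with α = n + 1/2, followed by evenness in v. -/
lemma integrable_pow_mul_add_rpow (n : ℕ) {h E : ℝ} (hh : 0 < h) (hE : n + 1 / 2 < E) :
    Integrable (fun v : ℝ => v ^ (2 * n) * (v ^ 2 + h) ^ (-E)) ∧
    ∫ v : ℝ, v ^ (2 * n) * (v ^ 2 + h) ^ (-E) =
      h ^ (n + 1 / 2 - E) *
        (Real.Gamma (n + 1 / 2) * Real.Gamma (E - (n + 1 / 2)) / Real.Gamma E) := by
  have hα : (0 : ℝ) < n + 1 / 2 := by positivity
  have e : ∀ v ∈ Ioi (0 : ℝ), (2 * v ^ ((2 : ℝ) - 1)) •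
      ((v ^ (2 : ℝ)) ^ ((n : ℝ) + 1 / 2 - 1) * (h + v ^ (2 : ℝ)) ^ (-E)) =
      2 * (v ^ (2 * n) * (v ^ 2 + h) ^ (-E)) := by
    intro v hv
    have hv' : 0 < v := hv
    rw [← Real.rpow_mul hv'.le, smul_eq_mul, mul_assoc, ← mul_assoc (v ^ ((2 : ℝ) - 1)),
      ← Real.rpow_add hv', show (2 : ℝ) - 1 + 2 * ((n : ℝ) + 1 / 2 - 1) = ((2 * n : ℕ) : ℝ) by
        push_cast; ring, Real.rpow_natCast, add_comm h]
    norm_num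
  have hI := integrableOn_rpow_mul_add_rpow hα hE hh
  have hV := integral_rpow_mul_add_rpow hα hE hh
  have hI2 : IntegrableOn (fun v : ℝ => v ^ (2 * n) * (v ^ 2 + h) ^ (-E)) (Ioi 0) := by
    have := (integrableOn_Ioi_comp_rpow_iff (fun s : ℝ => s ^ ((n : ℝ) + 1 / 2 - 1) *
      (h + s) ^ (-E)) (p := 2) (by norm_num)).2 hI
    rw [abs_of_pos (by norm_num : (0 : ℝ) < 2), integrableOn_congr_fun e measurableSet_Ioi] at this
    refine (this.const_mul (1 / 2)).congr (Filter.Eventually.of_forall fun v => ?_)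
    ring
  constructor
  · have hneg := ((Measure.measurePreserving_neg (volume : Measure ℝ)).integrableOn_comp_preimage
      (Homeomorph.neg ℝ).measurableEmbedding).2 hI2
    rw [← integrableOn_univ, ← Iic_union_Ioi (a := (0 : ℝ)), integrableOn_union]
    refine ⟨?_, hI2⟩
    rw [integrableOn_Iic_iff_integrableOn_Iio]
    have hset : (Neg.neg ⁻¹' Ioi (0 : ℝ)) = Iio 0 := by ext v; simp
    rw [hset] at hneg
    refine hneg.congr (Filter.Eventually.of_forall fun v => ?_)
    simp [pow_mul]
  · rw [← integral_comp_rpow_Ioi_of_pos (p := 2) (by norm_num),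
      setIntegral_congr_fun measurableSet_Ioi e, integral_const_mul] at hV
    rw [← hV]
    have := integral_comp_abs (f := fun w : ℝ => w ^ (2 * n) * (w ^ 2 + h) ^ (-E))
    simpa only [sq_abs, pow_mul] using this

/-- `∫ y^{2j} (1-y²)^r` over `[-1, 1]`. -/
lemma integral_pow_mul_one_sub_sq_pow (j r : ℕ) :
    ∫ y in (-1 : ℝ)..1, (1 - y ^ 2) ^ r * y ^ (2 * j) =
      2 * r.factorial * poch (1 / 2) j / poch (3 / 2) (r + j) := by
  induction r generalizing j with
  | zero =>
    simp only [pow_zero, one_mul, integral_pow, zero_add, Nat.factorial_zero, Nat.cast_one]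
    have h := poch_eq_div (b := 1 / 2) j
    rw [show (1 / 2 : ℝ) + 1 = 3 / 2 by norm_num] at h
    have h3 := poch_pos (x := 3 / 2) (by norm_num) j
    rw [show poch (1 / 2) j = 1 / 2 * poch (3 / 2) j / (1 / 2 + j) by
      rw [← h]; field_simp]
    have : (-1 : ℝ) ^ (2 * j + 1) = -1 := by simp [pow_succ, pow_mul]
    rw [this]
    field_simp
    push_cast
    field_simp
    ring
  | succ r ih =>
    have : ∀ y : ℝ, (1 - y ^ 2) ^ (r + 1) * y ^ (2 * j) =
        (1 - y ^ 2) ^ r * y ^ (2 * j) - (1 - y ^ 2) ^ r * y ^ (2 * (j + 1)) := by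
      intro y; ring
    simp_rw [this]
    rw [intervalIntegral.integral_sub (Continuous.intervalIntegrable (by fun_prop) _ _)
      (Continuous.intervalIntegrable (by fun_prop) _ _), ih, ih, poch_succ (1 / 2), Nat.factorial_succ,
      show r + (j + 1) = r + j + 1 by ring, show r + 1 + j = r + j + 1 by ring, poch_succ (3 / 2)]
    have h3 := poch_pos (x := 3 / 2) (by norm_num) (r + j)
    have h4 : (3 / 2 + ((r + j : ℕ) : ℝ)) ≠ 0 := by positivity
    push_cast at h4 ⊢
    field_simp
    ring

lemma integral_odd_pow_mul_one_sub_sq_pow (j r : ℕ) :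
    ∫ y in (-1 : ℝ)..1, (1 - y ^ 2) ^ r * y ^ (2 * j + 1) = 0 := by
  have h := intervalIntegral.integral_comp_neg (a := -1) (b := 1)
    (fun y : ℝ => (1 - y ^ 2) ^ r * y ^ (2 * j + 1))
  have e : ∀ y : ℝ, (1 - (-y) ^ 2) ^ r * (-y) ^ (2 * j + 1) =
      -((1 - y ^ 2) ^ r * y ^ (2 * j + 1)) := by
    intro y
    rw [neg_sq, Odd.neg_pow ⟨j, rfl⟩]; ring
  simp only [e, intervalIntegral.integral_neg, neg_neg] at h
  linarith

end Lifshitz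

/-! ### Quadratic transformation of ₂F₁ and the Gegenbauer-type expansion -/

namespace Lifshitz

open Set Filter Topology
open Finset.HasAntidiagonal (antidiagonal mem_antidiagonal)

lemma hasSum_of_eq {ι : Type*} {f g : ι → ℝ} {a b : ℝ} (h : HasSum f a) (hfg : ∀ i, f i = g i)
    (hab : a = b) : HasSum g b := by
  rw [← hab, ← funext hfg]; exact h

/-- Differentiation under the integral sign over a compact interval. -/
lemma hasDerivAt_integral_of_continuousOn {F F' : ℝ → ℝ → ℝ} {U : Set ℝ} (hU : IsOpen U) {a b : ℝ}
    (hab : a ≤ b) (hF : ContinuousOn (Function.uncurry F) (U ×ˢ Icc a b))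
    (hF' : ContinuousOn (Function.uncurry F') (U ×ˢ Icc a b))
    (hd : ∀ x ∈ U, ∀ y ∈ Icc a b, HasDerivAt (fun x => F x y) (F' x y) x) {x₀ : ℝ} (hx₀ : x₀ ∈ U) :
    HasDerivAt (fun x => ∫ y in a..b, F x y) (∫ y in a..b, F' x₀ y) x₀ := by
  obtain ⟨δ, hδ, hsub⟩ := Metric.nhds_basis_closedBall.mem_iff.1 (hU.mem_nhds hx₀)
  have hcomp : IsCompact (Metric.closedBall x₀ δ ×ˢ Icc a b) :=
    (isCompact_closedBall x₀ δ).prod isCompact_Icc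
  obtain ⟨C, hC⟩ := hcomp.exists_bound_of_continuousOn
    (hF'.mono (prod_mono_left hsub))
  have hcont : ∀ G : ℝ → ℝ → ℝ, ContinuousOn (Function.uncurry G) (U ×ˢ Icc a b) → ∀ x ∈ U,
      ContinuousOn (G x) (Icc a b) := fun G hG x hx =>
    hG.comp (f := fun y => (x, y)) (by fun_prop) (fun y hy => ⟨hx, hy⟩)
  have hint : ∀ G : ℝ → ℝ → ℝ, ContinuousOn (Function.uncurry G) (U ×ˢ Icc a b) → ∀ x ∈ U,
      IntervalIntegrable (G x) volume a b := fun G hG x hx =>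
    ContinuousOn.intervalIntegrable (by rw [uIcc_of_le hab]; exact hcont G hG x hx)
  refine (intervalIntegral.hasDerivAt_integral_of_dominated_loc_of_deriv_le (bound := fun _ => C)
    (Metric.closedBall_mem_nhds x₀ hδ) ?_ (hint F hF x₀ hx₀)
    (by simpa [uIoc_of_le hab] using (hint F' hF' x₀ hx₀).1.aestronglyMeasurable) ?_ (by simp) ?_).2
  · filter_upwards [hU.mem_nhds hx₀] with x hx
    simpa [uIoc_of_le hab] using (hint F hF x hx).1.aestronglyMeasurable
  · refine Eventually.of_forall fun y hy x hx => ?_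
    rw [uIoc_of_le hab] at hy
    exact hC (x, y) ⟨hx, Ioc_subset_Icc_self hy⟩
  · refine Eventually.of_forall fun y hy x hx => ?_
    rw [uIoc_of_le hab] at hy
    exact hd x (hsub hx) y (Ioc_subset_Icc_self hy)

lemma analyticOnNhd_tsum_pow {c : ℕ → ℝ} (hc : ∀ x : ℝ, |x| < 1 → Summable fun n => c n * x ^ n) :
    AnalyticOnNhd ℝ (fun x => ∑' n, c n * x ^ n) (Ioo (-1) 1) := by
  set p := FormalMultilinearSeries.ofScalars ℝ c with hp
  have hr : 1 ≤ p.radius := by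
    refine ENNReal.le_of_forall_nnreal_lt fun ρ hρ => ?_
    refine p.le_radius_of_summable ?_
    have : |(ρ : ℝ)| < 1 := by simpa using hρ
    refine (hc ρ this).norm.congr fun n => ?_
    simp [hp]
  have h := (p.hasFPowerSeriesOnBall (lt_of_lt_of_le one_pos hr)).analyticOnNhd
  have h2 : p.sum = fun x => ∑' n, c n * x ^ n := by
    funext x
    simp [FormalMultilinearSeries.sum, hp, mul_comm]
  rw [h2] at h
  refine h.mono fun x hx => ?_
  rw [mem_eball_zero_iff]
  refine lt_of_lt_of_le ?_ hr
  rw [← ofReal_norm, Real.norm_eq_abs]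
  exact ENNReal.ofReal_lt_one.2 (abs_lt.2 hx)

/-- Coefficient identity behind the quadratic transformation. -/
lemma sum_antidiagonal_hyp21Coeff {l β : ℝ} (hβ : 0 < β) (n : ℕ) :
    ∑ ij ∈ antidiagonal n, hyp21Coeff (l / 2) ((l + 1) / 2) β ij.1 * 4 ^ ij.1 *
      (poch (l + 2 * ij.1) ij.2 / ij.2.factorial * (-1) ^ ij.2) =
      hyp21Coeff l (l + 1 - β) β n := by
  -- The identity is Chu–Vandermonde with parameters l + n and 1 - β - n; reflection turns (1-β-n)_j
  -- into (-1)^j (β+i)_j, which cancels against (β)_n.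
  have h := sum_choose_poch (l + n) (1 - β - n) n
  rw [show l + n + (1 - β - n) = l + 1 - β by ring] at h
  rw [hyp21Coeff, ← h, Finset.mul_sum, Finset.sum_div]
  refine Finset.sum_congr rfl fun ij hij => ?_
  obtain ⟨i, j⟩ := ij
  have hn : i + j = n := mem_antidiagonal.1 hij
  subst hn
  have e1 : (4 : ℝ) ^ i * poch (l / 2) i * poch ((l + 1) / 2) i = poch l (2 * i) := by
    have := poch_two_mul (l / 2) i
    rw [mul_div_cancel₀ l two_ne_zero, show l / 2 + 1 / 2 = (l + 1) / 2 by ring] at this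
    exact this.symm
  have e2 : poch l (2 * i) * poch (l + 2 * i) j = poch l (i + j) * poch (l + (i + j : ℕ)) i := by
    have h1 := poch_add l (2 * i) j
    rw [show 2 * i + j = (i + j) + i by ring, poch_add] at h1
    rw [h1]; push_cast; rfl
  have e3 : poch (1 - β - (i + j : ℕ)) j * (-1) ^ j = poch (β + i) j := by
    rw [poch_reflect (β + i) j, show 1 - (β + i) - j = 1 - β - (i + j : ℕ) by push_cast; ring]
    ring
  have e4 : poch β (i + j) = poch β i * poch (β + i) j := poch_add β i j
  have hc := Nat.add_choose_mul_factorial_mul_factorial i j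
  rw [← Nat.choose_symm_add] at hc
  have hc' : ((i + j).choose i : ℝ) * i.factorial * j.factorial = (i + j).factorial := by
    exact_mod_cast hc
  have p1 := poch_ne_zero hβ i
  have p2 := poch_ne_zero (x := β + i) (by positivity) j
  have f1 : (i.factorial : ℝ) ≠ 0 := by positivity
  have f2 : (j.factorial : ℝ) ≠ 0 := by positivity
  have f3 : ((i + j).choose i : ℝ) ≠ 0 := by exact_mod_cast (Nat.choose_pos (by omega)).ne'
  have e3' : poch (1 - β - (i + j : ℕ)) j = (-1) ^ j * poch (β + i) j := by
    rw [← e3, mul_comm, mul_assoc, ← mul_pow]; simp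
  simp only [hyp21Coeff]
  rw [← hc', e4, e3']
  field_simp
  linear_combination (poch (l + 2 * i) j) * e1 + e2

/-- Expanding each (1 + x)^(-l-2j) by the binomial series gives a double series, regrouped along
antidiagonals. Absolute convergence amounts to 4x/(1-x)² < 1, which x < 1/10 guarantees; the rest of
[0, 1) is reached by analytic continuation. -/
lemma hyp21_quadratic_of_small {l β x : ℝ} (hl : 0 < l) (hβ : 0 < β) (hx : 0 < x)
    (hx' : x < 1 / 10) :
    HasSum (fun n => hyp21Coeff l (l + 1 - β) β n * x ^ n)
      ((1 + x) ^ (-l) * ∑' j, hyp21Coeff (l / 2) ((l + 1) / 2) β j * (4 * x / (1 + x) ^ 2) ^ j) := by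
  set g := hyp21Coeff (l / 2) ((l + 1) / 2) β with hg
  have hg0 : ∀ j, 0 ≤ g j := fun j => by
    have h1 := poch_pos (x := l / 2) (by positivity) j
    have h2 := poch_pos (x := (l + 1) / 2) (by positivity) j
    have h3 := poch_pos hβ j
    rw [hg, hyp21Coeff]; positivity
  have hgs : ∀ u : ℝ, |u| < 1 → Summable fun j => g j * u ^ j := fun u hu => by
    simpa using hyp21Coeff_summable (x := l / 2) (b := (l + 1) / 2) (by positivity)
      (by positivity) hβ hu 0
  let T : ℕ × ℕ → ℝ := fun q => g q.1 * (4 * x) ^ q.1 *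
    (poch (l + 2 * q.1) q.2 / q.2.factorial * (-x) ^ q.2)
  have habs : |x| < 1 := by rw [abs_of_pos hx]; linarith
  have hrow : ∀ j : ℕ, ∀ s : ℝ, |s| < 1 → (1 - s) ^ (-(l + 2 * j)) =
      (1 - s) ^ (-l) * ((1 / (1 - s) ^ 2) ^ j) := fun j s hs => by
    have h1 : 0 < 1 - s := by linarith [(abs_lt.1 hs).2]
    rw [neg_add, Real.rpow_add h1, Real.rpow_neg h1.le (2 * (j : ℝ)),
      show (2 : ℝ) * j = ((2 * j : ℕ) : ℝ) by push_cast; ring, Real.rpow_natCast, pow_mul, one_div,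
      inv_pow]
  have hrow1 : ∀ j : ℕ, HasSum (fun i => T (j, i))
      ((1 + x) ^ (-l) * (g j * (4 * x / (1 + x) ^ 2) ^ j)) := fun j => by
    have := (hasSum_poch_binomial (l + 2 * j) (x := -x) (by rwa [abs_neg])).mul_left
      (g j * (4 * x) ^ j)
    rw [hrow j (-x) (by rwa [abs_neg]), sub_neg_eq_add] at this
    refine hasSum_of_eq this (fun i => rfl) ?_
    rw [div_eq_mul_one_div (4 * x), mul_pow]; ring
  have hrow2 : ∀ j : ℕ, HasSum (fun i => ‖T (j, i)‖)
      ((1 - x) ^ (-l) * (g j * (4 * x / (1 - x) ^ 2) ^ j)) := fun j => by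
    have := (hasSum_poch_binomial (l + 2 * j) (x := x) habs).mul_left (g j * (4 * x) ^ j)
    rw [hrow j x habs] at this
    refine hasSum_of_eq this (fun i => ?_) ?_
    · have h1 := poch_pos (x := l + 2 * j) (by positivity) i
      simp only [T, norm_mul, norm_div, norm_pow, norm_neg, Real.norm_eq_abs, abs_of_pos hx,
        abs_of_nonneg (hg0 j), abs_of_pos h1, Nat.abs_cast, Nat.abs_ofNat]
    · rw [div_eq_mul_one_div (4 * x), mul_pow]; ring
  have hsmall : ∀ s : ℝ, 9 / 10 < s → |4 * x / s ^ 2| < 1 := fun s hs => by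
    rw [abs_of_nonneg (by positivity), div_lt_one (by positivity)]
    nlinarith
  have hT : Summable T := by
    refine Summable.of_norm ?_
    rw [summable_prod_of_nonneg (fun _ => norm_nonneg _)]
    refine ⟨fun j => (hrow2 j).summable, ?_⟩
    simp_rw [(hrow2 _).tsum_eq]
    exact (hgs _ (hsmall _ (by linarith))).mul_left _
  have hsum : ∑' q, T q = (1 + x) ^ (-l) * ∑' j, g j * (4 * x / (1 + x) ^ 2) ^ j := by
    rw [hT.tsum_prod, ← tsum_mul_left]
    exact tsum_congr fun j => (hrow1 j).tsum_eq
  have h1 := hT.hasSum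
  rw [hsum, ← Finset.HasAntidiagonal.sigmaAntidiagonalEquivProd.hasSum_iff] at h1
  have h2 := h1.sigma fun n => hasSum_fintype _
  refine hasSum_of_eq h2 (fun n => ?_) rfl
  rw [← sum_antidiagonal_hyp21Coeff hβ n, Finset.sum_mul, ← Finset.sum_coe_sort (antidiagonal n)]
  refine Finset.sum_congr rfl fun ij _ => ?_
  obtain ⟨⟨i, j⟩, hij⟩ := ij
  have hn : i + j = n := mem_antidiagonal.1 hij
  subst hn
  simp only [Function.comp_apply, Finset.HasAntidiagonal.sigmaAntidiagonalEquivProd_apply, T]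
  rw [neg_pow x, mul_pow, pow_add]
  ring

/-- The quadratic transformation of `₂F₁`. -/
lemma hyp21_quadratic {l β x : ℝ} (hl : 0 < l) (hβ : 0 < β) (hb : 0 < l + 1 - β + 1) (hx : 0 ≤ x)
    (hx' : x < 1) :
    ∑' n, hyp21Coeff l (l + 1 - β) β n * x ^ n =
      (1 + x) ^ (-l) * ∑' j, hyp21Coeff (l / 2) ((l + 1) / 2) β j * (4 * x / (1 + x) ^ 2) ^ j := by
  -- Both sides are analytic on (-1/10, 1), since 4x/(1+x)² maps this interval into (-1, 1). They
  -- agree near 1/20, hence everywhere.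
  have hU : IsPreconnected (Ioo (-(1 / 10) : ℝ) 1) := isPreconnected_Ioo
  have hK : AnalyticOnNhd ℝ (fun x : ℝ => ∑' n, hyp21Coeff l (l + 1 - β) β n * x ^ n)
      (Ioo (-1) 1) := analyticOnNhd_tsum_pow fun x hx => by
    simpa using hyp21Coeff_summable hl hb hβ hx 0
  have hg : AnalyticOnNhd ℝ (fun x : ℝ => ∑' j, hyp21Coeff (l / 2) ((l + 1) / 2) β j * x ^ j)
      (Ioo (-1) 1) := analyticOnNhd_tsum_pow fun x hx => by
    simpa using hyp21Coeff_summable (x := l / 2) (b := (l + 1) / 2) (by positivity)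
      (by positivity) hβ hx 0
  have hu : AnalyticOnNhd ℝ (fun x : ℝ => 4 * x / (1 + x) ^ 2) (Ioo (-(1 / 10)) 1) := fun x hx => by
    have : (1 + x) ^ 2 ≠ 0 := by nlinarith [hx.1]
    fun_prop (disch := assumption)
  have hmaps : MapsTo (fun x : ℝ => 4 * x / (1 + x) ^ 2) (Ioo (-(1 / 10)) 1) (Ioo (-1) 1) := by
    intro x hx
    have h1 : 0 < (1 + x) ^ 2 := by nlinarith [hx.1]
    constructor
    · rw [lt_div_iff₀ h1]; nlinarith [hx.1]
    · rw [div_lt_one h1]; nlinarith [hx.2, mul_pos (sub_pos.2 hx.2) (sub_pos.2 hx.2)]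
  have hp : AnalyticOnNhd ℝ (fun x : ℝ => (1 + x) ^ (-l)) (Ioo (-(1 / 10)) 1) := fun x hx => by
    have h1 : 0 < 1 + x := by linarith [hx.1]
    have h2 : AnalyticAt ℝ (fun x : ℝ => Real.exp (Real.log (1 + x) * -l)) x := by
      have : AnalyticAt ℝ (fun x : ℝ => Real.log (1 + x)) x := AnalyticAt.log (by fun_prop) h1
      fun_prop
    refine h2.congr ?_
    filter_upwards [isOpen_Ioo.mem_nhds hx] with y hy
    rw [Real.rpow_def_of_pos (by linarith [hy.1])]
  refine (hK.mono (Ioo_subset_Ioo_left (by norm_num))).eqOn_of_preconnected_of_eventuallyEq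
    (hp.mul (hg.comp hu hmaps)) hU (z₀ := 1 / 20) (by constructor <;> norm_num) ?_
    (show x ∈ Ioo (-(1 / 10) : ℝ) 1 from ⟨by linarith, hx'⟩)
  filter_upwards [isOpen_Ioo.mem_nhds (show (1 / 20 : ℝ) ∈ Ioo (0 : ℝ) (1 / 10) by
    constructor <;> norm_num)] with y hy
  exact (hyp21_quadratic_of_small hl hβ hy.1 hy.2).tsum_eq

/-- The binomial series in vy is integrated term by term; odd powers of y drop out by symmetry, and
duplication of the Pochhammer symbol turns the even ones into a ₂F₁ in v². -/
lemma hasSum_integral_one_add_mul (r : ℕ) {l v : ℝ} (hl : 0 < l) (hv : |v| < 1) :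
    HasSum (fun j => 2 * r.factorial / poch (3 / 2) r *
        (hyp21Coeff (l / 2) ((l + 1) / 2) (r + 3 / 2) j * (v ^ 2) ^ j))
      (∫ y in (-1 : ℝ)..1, (1 - y ^ 2) ^ r * (1 + v * y) ^ (-l)) := by
  have hI : ∀ y ∈ uIcc (-1 : ℝ) 1, |y| ≤ 1 := fun y hy => by
    rw [uIcc_of_le (by norm_num)] at hy
    exact abs_le.2 hy
  have hcont : ∀ n : ℕ, Continuous fun y : ℝ =>
      (1 - y ^ 2) ^ r * (poch l n / n.factorial * (-(v * y)) ^ n) := fun n => by fun_prop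
  have h1 : HasSum (fun n : ℕ => ∫ y in (-1 : ℝ)..1,
        (1 - y ^ 2) ^ r * (poch l n / n.factorial * (-(v * y)) ^ n))
      (∫ y in (-1 : ℝ)..1, ∑' n : ℕ, (1 - y ^ 2) ^ r * (poch l n / n.factorial * (-(v * y)) ^ n)) := by
    refine intervalIntegral.hasSum_intervalIntegral_of_summable_norm
      (f := fun n => ⟨fun y => (1 - y ^ 2) ^ r * (poch l n / n.factorial * (-(v * y)) ^ n),
        hcont n⟩) ?_
    refine Summable.of_nonneg_of_le (fun _ => norm_nonneg _) (fun n => ?_)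
      (hasSum_poch_binomial l (x := |v|) (by rwa [abs_abs])).summable
    have hpl := poch_pos hl n
    refine (ContinuousMap.norm_le _ (by positivity)).2 fun y => ?_
    have hy : |(y : ℝ)| ≤ 1 := hI y y.2
    have hy2 : (y : ℝ) ^ 2 ≤ 1 := by rwa [sq_le_one_iff_abs_le_one]
    simp only [ContinuousMap.restrict_apply, ContinuousMap.coe_mk, norm_mul, norm_pow, norm_div,
      norm_neg, Real.norm_eq_abs, abs_of_pos hpl, Nat.abs_cast]
    rw [abs_of_nonneg (by linarith : 0 ≤ 1 - (y : ℝ) ^ 2)]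
    have a1 : (1 - (y : ℝ) ^ 2) ^ r ≤ 1 := pow_le_one₀ (by linarith) (by nlinarith [sq_nonneg (y:ℝ)])
    have a2 : (|v| * |(y : ℝ)|) ^ n ≤ |v| ^ n :=
      pow_le_pow_left₀ (by positivity) (mul_le_of_le_one_right (abs_nonneg v) hy) n
    calc _ ≤ 1 * (poch l n / n.factorial * |v| ^ n) := by gcongr
      _ = _ := one_mul _
  have h2 : ∫ y in (-1 : ℝ)..1, ∑' n : ℕ, (1 - y ^ 2) ^ r *
      (poch l n / n.factorial * (-(v * y)) ^ n) =
      ∫ y in (-1 : ℝ)..1, (1 - y ^ 2) ^ r * (1 + v * y) ^ (-l) := by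
    refine intervalIntegral.integral_congr fun y hy => ?_
    rw [uIcc_of_le (by norm_num)] at hy
    have hvy : |-(v * y)| < 1 := by
      rw [abs_neg, abs_mul]
      exact lt_of_le_of_lt (mul_le_of_le_one_right (abs_nonneg v) (abs_le.2 hy)) hv
    have := (hasSum_poch_binomial l hvy).tsum_eq
    simp only [tsum_mul_left, this, sub_neg_eq_add]
  rw [h2, ← (mul_right_injective₀ (two_ne_zero' ℕ)).hasSum_iff] at h1
  · refine hasSum_of_eq h1 (fun j => ?_) rfl
    have e : ∀ y : ℝ, (1 - y ^ 2) ^ r * (poch l (2 * j) / (2 * j).factorial * (-(v * y)) ^ (2 * j)) =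
        poch l (2 * j) / (2 * j).factorial * (v ^ 2) ^ j * ((1 - y ^ 2) ^ r * y ^ (2 * j)) := by
      intro y
      rw [pow_mul, neg_sq, mul_pow, mul_pow, ← pow_mul y]; ring
    simp only [Function.comp_apply, e, intervalIntegral.integral_const_mul,
      integral_pow_mul_one_sub_sq_pow]
    simp only [hyp21Coeff, factorial_two_mul]
    have e1 := poch_two_mul (l / 2) j
    rw [mul_div_cancel₀ l two_ne_zero, show l / 2 + 1 / 2 = (l + 1) / 2 by ring] at e1
    rw [e1, poch_add, add_comm (3 / 2 : ℝ) r]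
    have p1 := poch_ne_zero (x := 1 / 2) (by norm_num) j
    have p2 := poch_ne_zero (x := 3 / 2) (by norm_num) r
    have p3 := poch_ne_zero (x := r + 3 / 2) (by positivity) j
    field_simp
  · intro n hn
    have hodd : Odd n := by
      rw [← Nat.not_even_iff_odd]
      rintro ⟨k, hk⟩
      exact hn ⟨k, by simp only; omega⟩
    obtain ⟨j, rfl⟩ := hodd
    have e : ∀ y : ℝ, (1 - y ^ 2) ^ r * (poch l (2 * j + 1) / (2 * j + 1).factorial *
        (-(v * y)) ^ (2 * j + 1)) = -(poch l (2 * j + 1) / (2 * j + 1).factorial * v ^ (2 * j + 1)) *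
          ((1 - y ^ 2) ^ r * y ^ (2 * j + 1)) := by
      intro y
      rw [Odd.neg_pow ⟨j, rfl⟩, mul_pow]; ring
    simp only [e, intervalIntegral.integral_const_mul, integral_odd_pow_mul_one_sub_sq_pow, mul_zero]

/-- The expression is the convex combination of (S + w)² and (S - w)² with weights (1 ± y)/2. -/
lemma sq_add_sq_add_pos {S w y : ℝ} (hw : |w| < S) (hy : y ∈ Icc (-1 : ℝ) 1) :
    0 < S ^ 2 + w ^ 2 + 2 * y * S * w := by
  have h1 := abs_lt.1 hw
  have h2 : 0 < (S + w) ^ 2 := by have : 0 < S + w := by linarith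
                                  positivity
  have h3 : 0 < (S - w) ^ 2 := by have : 0 < S - w := by linarith
                                  positivity
  rcases hy.1.eq_or_lt with h | h
  · rw [← h]; nlinarith
  · nlinarith [hy.2, mul_pos (by linarith : 0 < y + 1) h2,
      mul_nonneg (by linarith [hy.2] : 0 ≤ 1 - y) h3.le]

/-- Gegenbauer-type expansion. -/
lemma hasSum_integral_gegenbauer (r : ℕ) {l S w : ℝ} (hl : 0 < l) (hb : 0 < l - r - 1 / 2 + 1)
    (hw : |w| < S) :
    HasSum (fun n => 2 * r.factorial / poch (3 / 2) r *
        (hyp21Coeff l (l - r - 1 / 2) (r + 3 / 2) n * (w ^ (2 * n) * S ^ (-(2 * l + 2 * n)))))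
      (∫ y in (-1 : ℝ)..1, (1 - y ^ 2) ^ r * (S ^ 2 + w ^ 2 + 2 * y * S * w) ^ (-l)) := by
  have hS : 0 < S := lt_of_le_of_lt (abs_nonneg w) hw
  have hβ : (0 : ℝ) < r + 3 / 2 := by positivity
  have hbe : l - r - 1 / 2 = l + 1 - (r + 3 / 2) := by ring
  rw [hbe] at hb ⊢
  have hSw : w ^ 2 < S ^ 2 := sq_lt_sq' (abs_lt.1 hw).1 (abs_lt.1 hw).2
  have hpos : 0 < S ^ 2 + w ^ 2 := by positivity
  -- Extracting S² + w² leaves 1 + vy with v = 2Sw/(S² + w²), and v² = 4x/(1+x)² for x = w²/S². This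
  -- is the argument of the quadratic transformation, which therefore replaces powers of v² by
  -- monomials in w and S.
  set x := w ^ 2 / S ^ 2 with hx
  have hx0 : 0 ≤ x := by positivity
  have hx1 : x < 1 := by rwa [hx, div_lt_one (by positivity)]
  set v := 2 * S * w / (S ^ 2 + w ^ 2) with hv
  have hv1 : |v| < 1 := by
    have h1 := abs_lt.1 hw
    rw [abs_lt, hv, lt_div_iff₀ hpos, div_lt_one hpos]
    constructor <;> nlinarith [mul_pos (by linarith : 0 < S + w) (by linarith : 0 < S + w),
      mul_pos (by linarith : 0 < S - w) (by linarith : 0 < S - w)]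
  have hvx : v ^ 2 = 4 * x / (1 + x) ^ 2 := by
    rw [hv, hx]; field_simp; ring
  have h1 := hasSum_integral_one_add_mul r hl hv1
  have hq := hyp21_quadratic hl hβ hb hx0 hx1
  have hsq : S ^ 2 + w ^ 2 = S ^ 2 * (1 + x) := by rw [hx]; field_simp
  have hint : ∫ y in (-1 : ℝ)..1, (1 - y ^ 2) ^ r * (S ^ 2 + w ^ 2 + 2 * y * S * w) ^ (-l) =
      (S ^ 2 + w ^ 2) ^ (-l) * ∫ y in (-1 : ℝ)..1, (1 - y ^ 2) ^ r * (1 + v * y) ^ (-l) := by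
    rw [← intervalIntegral.integral_const_mul]
    refine intervalIntegral.integral_congr fun y hy => ?_
    rw [uIcc_of_le (by norm_num)] at hy
    have h2 : S ^ 2 + w ^ 2 + 2 * y * S * w = (S ^ 2 + w ^ 2) * (1 + v * y) := by
      rw [hv]; field_simp
    have h3 : 0 < 1 + v * y := by
      have := sq_add_sq_add_pos hw hy
      rw [h2] at this
      exact (mul_pos_iff_of_pos_left hpos).1 this
    simp only [h2, Real.mul_rpow hpos.le h3.le]
    ring
  have hsum := (hyp21Coeff_summable (x := l) hl hb hβ
    (show |x| < 1 by rwa [abs_of_nonneg hx0]) 0).hasSum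
  simp only [pow_zero, one_mul] at hsum
  rw [hint, ← h1.tsum_eq, hvx, tsum_mul_left]
  have hS2 : (S ^ 2) ^ (-l) = S ^ (-(2 * l)) := by
    rw [← Real.rpow_natCast, ← Real.rpow_mul hS.le]; congr 1; push_cast; ring
  refine hasSum_of_eq (hsum.mul_left (2 * r.factorial / poch (3 / 2) r * S ^ (-(2 * l))))
    (fun n => ?_) ?_
  · have : S ^ (-(2 * l + 2 * n)) = S ^ (-(2 * l)) * (S ^ (2 * n))⁻¹ := by
      rw [neg_add, Real.rpow_add hS, Real.rpow_neg hS.le (2 * (n : ℝ)),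
        show (2 : ℝ) * n = ((2 * n : ℕ) : ℝ) by push_cast; ring, Real.rpow_natCast]
    rw [this, hx, div_pow, ← pow_mul, ← pow_mul]
    ring
  · rw [hq, hsq, Real.mul_rpow (by positivity) (by positivity), hS2]; ring

lemma hasDerivAt_integral_gegenbauer (r : ℕ) (l : ℝ) {S w : ℝ} (hw : |w| < S) :
    HasDerivAt (fun S => ∫ y in (-1 : ℝ)..1,
        (1 - y ^ 2) ^ r * (S ^ 2 + w ^ 2 + 2 * y * S * w) ^ (-l))
      (∫ y in (-1 : ℝ)..1, (1 - y ^ 2) ^ r *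
        ((2 * S + 2 * y * w) * -l * (S ^ 2 + w ^ 2 + 2 * y * S * w) ^ (-l - 1))) S := by
  have hne : ∀ q ∈ Ioi |w| ×ˢ Icc (-1 : ℝ) 1,
      q.1 ^ 2 + w ^ 2 + 2 * q.2 * q.1 * w ≠ 0 := fun q hq => (sq_add_sq_add_pos hq.1 hq.2).ne'
  refine hasDerivAt_integral_of_continuousOn (U := Ioi |w|) isOpen_Ioi (by norm_num)
    (F := fun S y => (1 - y ^ 2) ^ r * (S ^ 2 + w ^ 2 + 2 * y * S * w) ^ (-l))
    (F' := fun S y => (1 - y ^ 2) ^ r *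
        ((2 * S + 2 * y * w) * -l * (S ^ 2 + w ^ 2 + 2 * y * S * w) ^ (-l - 1))) ?_ ?_ ?_ hw
  · unfold Function.uncurry
    exact ContinuousOn.mul (by fun_prop)
      (ContinuousOn.rpow_const (by fun_prop) fun q hq => Or.inl (hne q hq))
  · unfold Function.uncurry
    exact ContinuousOn.mul (by fun_prop) (ContinuousOn.mul (by fun_prop)
      (ContinuousOn.rpow_const (by fun_prop) fun q hq => Or.inl (hne q hq)))
  · intro x hx y hy
    have h1 : HasDerivAt (fun x : ℝ => x ^ 2 + w ^ 2 + 2 * y * x * w) (2 * x + 2 * y * w) x := by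
      have := (((hasDerivAt_id x).pow 2).add_const (w ^ 2)).add
        (((hasDerivAt_id x).const_mul (2 * y)).mul_const w)
      refine this.congr_deriv ?_
      simp
    exact (h1.rpow_const (Or.inl (hne (x, y) ⟨hx, hy⟩))).const_mul _

/-- The expansion of the derivative with respect to `S`. -/
lemma hasSum_integral_gegenbauer_deriv (r : ℕ) {l S w : ℝ} (hl : 0 < l)
    (hb : 0 < l - r - 1 / 2 + 1) (hw : |w| < S) :
    HasSum (fun n : ℕ => 2 * r.factorial / poch (3 / 2) r *
        (hyp21Coeff l (l - r - 1 / 2) (r + 3 / 2) n * (2 * l + 2 * n) *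
          (w ^ (2 * n) * S ^ (-(2 * l + 2 * n + 1)))))
      (∫ y in (-1 : ℝ)..1, (1 - y ^ 2) ^ r *
        ((2 * S + 2 * y * w) * l * (S ^ 2 + w ^ 2 + 2 * y * S * w) ^ (-l - 1))) := by
  set b := l - r - 1 / 2 with hbdef
  -- The differentiated terms decrease in S, so their values at S₁ < S form a majorant on (S₁, ∞);
  -- it is summable because |w| < S₁.
  obtain ⟨S₁, hw1, hS1⟩ := exists_between hw
  have hS₁ : 0 < S₁ := lt_of_le_of_lt (abs_nonneg w) hw1
  have hS : 0 < S := hS₁.trans hS1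
  set κ : ℝ := 2 * r.factorial / poch (3 / 2) r with hκ
  have hκ0 : 0 < κ := by
    have := poch_pos (x := 3 / 2) (by norm_num) r
    positivity
  let u : ℕ → ℝ := fun n => κ * (|hyp21Coeff l b (r + 3 / 2) n| * (2 * l + 2 * n) *
          (w ^ (2 * n) * S₁ ^ (-(2 * l + 2 * n + 1))))
  have hu : Summable u := by
    have hρ : |w ^ 2 / S₁ ^ 2| < 1 := by
      rw [abs_of_nonneg (by positivity), div_lt_one (by positivity)]
      exact sq_lt_sq' (abs_lt.1 hw1).1 (abs_lt.1 hw1).2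
    have s0 := (hyp21Coeff_summable hl hb (y := r + 3 / 2) (by positivity) hρ 0).abs
    have s1 := (hyp21Coeff_summable hl hb (y := r + 3 / 2) (by positivity) hρ 1).abs
    refine (((s0.mul_left (2 * l)).add (s1.mul_left 2)).mul_left
      (κ * S₁ ^ (-(2 * l + 1)))).congr fun n => ?_
    have : S₁ ^ (-(2 * l + 2 * n + 1)) = S₁ ^ (-(2 * l + 1)) * (S₁ ^ (2 * n))⁻¹ := by
      rw [show -(2 * l + 2 * n + 1) = -(2 * l + 1) + -(2 * (n : ℝ)) by ring, Real.rpow_add hS₁,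
        Real.rpow_neg hS₁.le (2 * (n : ℝ)),
        show (2 : ℝ) * n = ((2 * n : ℕ) : ℝ) by push_cast; ring, Real.rpow_natCast]
    simp only [u, this, abs_mul, abs_pow, abs_div, pow_zero, pow_one, one_mul, Nat.abs_cast,
      sq_abs]
    rw [div_pow, ← pow_mul, ← pow_mul]
    ring
  have hterm : ∀ (n : ℕ) (y : ℝ), y ∈ Ioi S₁ → HasDerivAt
      (fun S => κ * (hyp21Coeff l b (r + 3 / 2) n * (w ^ (2 * n) * S ^ (-(2 * l + 2 * n)))))
      (-(κ * (hyp21Coeff l b (r + 3 / 2) n * (2 * l + 2 * n) *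
          (w ^ (2 * n) * y ^ (-(2 * l + 2 * n + 1)))))) y := fun n y hy => by
    have hy0 : y ≠ 0 := (hS₁.trans hy).ne'
    refine (((((hasDerivAt_id y).rpow_const (p := -(2 * l + 2 * n)) (Or.inl hy0)).const_mul
      (w ^ (2 * n))).const_mul _).const_mul _).congr_deriv ?_
    simp only [id]
    rw [show -(2 * l + 2 * (n : ℝ)) - 1 = -(2 * l + 2 * n + 1) by ring]
    ring
  have hbound : ∀ (n : ℕ) (y : ℝ), y ∈ Ioi S₁ → ‖-(κ * (hyp21Coeff l b (r + 3 / 2) n *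
      (2 * l + 2 * n) * (w ^ (2 * n) * y ^ (-(2 * l + 2 * n + 1)))))‖ ≤ u n := fun n y hy => by
    have hy0 : 0 < y := hS₁.trans hy
    have h1 : 0 ≤ w ^ (2 * n) := by rw [pow_mul]; positivity
    rw [norm_neg, norm_mul, norm_mul, norm_mul, norm_mul, Real.norm_of_nonneg hκ0.le,
      Real.norm_of_nonneg (by positivity : 0 ≤ 2 * l + 2 * (n : ℝ)), Real.norm_of_nonneg h1,
      Real.norm_of_nonneg (by positivity : 0 ≤ y ^ (-(2 * l + 2 * (n : ℝ) + 1))), Real.norm_eq_abs]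
    simp only [u]
    have := Real.rpow_le_rpow_of_nonpos hS₁ (le_of_lt hy)
      (by have : 0 ≤ 2 * l + 2 * (n : ℝ) + 1 := by positivity
          linarith : -(2 * l + 2 * (n : ℝ) + 1) ≤ 0)
    gcongr
  have hd := hasDerivAt_tsum_of_isPreconnected hu isOpen_Ioi isPreconnected_Ioi hterm hbound hS1
    (hasSum_integral_gegenbauer r hl hb hw).summable hS1
  have hd2 := hasDerivAt_integral_gegenbauer r l hw
  have heq := (hd.congr_of_eventuallyEq (f₁ := fun S => ∫ y in (-1 : ℝ)..1,
        (1 - y ^ 2) ^ r * (S ^ 2 + w ^ 2 + 2 * y * S * w) ^ (-l)) (by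
    filter_upwards [isOpen_Ioi.mem_nhds (show S ∈ Ioi |w| from hw)] with s hs
    exact (hasSum_integral_gegenbauer r hl hb hs).tsum_eq.symm)).unique hd2
  have hsm : Summable fun n => -(κ * (hyp21Coeff l b (r + 3 / 2) n *
      (2 * l + 2 * n) * (w ^ (2 * n) * S ^ (-(2 * l + 2 * n + 1))))) :=
    Summable.of_norm_bounded hu fun n => hbound n S hS1
  have := hsm.hasSum
  rw [heq] at this
  refine hasSum_of_eq this.neg (fun n => neg_neg _) ?_
  rw [← intervalIntegral.integral_neg]
  refine intervalIntegral.integral_congr fun y _ => ?_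
  ring

/-! ### Feynman parametrisation of the bubble -/

/-- The Feynman-parameter denominator, with parameter `y ∈ [-1, 1]` and squared masses
`M₁`, `M₂`. -/
noncomputable def feynDen (p M₁ M₂ y : ℝ) : ℝ :=
  (1 - y ^ 2) * p ^ 2 / 4 + ((1 + y) * M₂ + (1 - y) * M₁) / 2

lemma feynDen_pos {M₁ M₂ y : ℝ} (p : ℝ) (h₁ : 0 < M₁) (h₂ : 0 < M₂) (hy : y ∈ Icc (-1 : ℝ) 1) :
    0 < feynDen p M₁ M₂ y := by
  have h3 : 0 ≤ (1 - y ^ 2) * p ^ 2 := by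
    have : 0 ≤ 1 - y ^ 2 := by nlinarith [hy.1, hy.2]
    positivity
  have h4 : 0 < (1 + y) * M₂ + (1 - y) * M₁ := by
    rcases hy.1.eq_or_lt with h | h
    · rw [← h]; linarith
    · have := mul_pos (by linarith : 0 < 1 + y) h₂
      have := mul_nonneg (by linarith [hy.2] : 0 ≤ 1 - y) h₁.le
      linarith
  unfold feynDen
  linarith

lemma integral_feynman_parameter {A B : ℝ} (hA : 0 < A) (hB : 0 < B) :
    ∫ y in (-1 : ℝ)..1, (((1 + y) * B + (1 - y) * A) / 2) ^ (-3 : ℝ) =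
      (A + B) / (A ^ 2 * B ^ 2) := by
  have hpos : ∀ y ∈ Icc (-1 : ℝ) 1, 0 < ((1 + y) * B + (1 - y) * A) / 2 := fun y hy => by
    have := feynDen_pos 0 hA hB hy
    simpa [feynDen] using this
  -- With L the linear interpolation from A to B, the primitive is (A⁻² - L⁻²)/(B - A) with the
  -- factor B - A cancelled, so the case A = B needs no separate treatment.
  have e : ∀ y ∈ uIcc (-1 : ℝ) 1, HasDerivAt
      (fun y => (1 + y) * (((1 + y) * B + (1 - y) * A) / 2 + A) /
        (2 * A ^ 2 * (((1 + y) * B + (1 - y) * A) / 2) ^ 2))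
      ((((1 + y) * B + (1 - y) * A) / 2) ^ (-3 : ℝ)) y := by
    intro y hy
    rw [uIcc_of_le (by norm_num)] at hy
    have hL := hpos y hy
    have h1 : HasDerivAt (fun y : ℝ => 1 + y) 1 y := (hasDerivAt_id y).const_add 1
    have h2 : HasDerivAt (fun y : ℝ => ((1 + y) * B + (1 - y) * A) / 2) ((B - A) / 2) y := by
      refine ((h1.mul_const B).add
        (((hasDerivAt_id y).const_sub 1).mul_const A)).div_const 2 |>.congr_deriv ?_
      ring
    have h3 := (h1.mul (h2.add_const A)).div ((h2.pow 2).const_mul (2 * A ^ 2))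
      (mul_pos (by positivity) (pow_pos hL 2)).ne'
    refine h3.congr_deriv ?_
    rw [show (-3 : ℝ) = ((-3 : ℤ) : ℝ) by norm_num, Real.rpow_intCast]
    have hL' : (1 + y) * B + (1 - y) * A ≠ 0 := by linarith
    simp only [Pi.pow_apply, zpow_neg, Pi.mul_apply]
    norm_cast
    field_simp
    ring
  have hcont : ContinuousOn (fun y : ℝ => (((1 + y) * B + (1 - y) * A) / 2) ^ (-3 : ℝ))
      (uIcc (-1) 1) := by
    rw [uIcc_of_le (by norm_num)]
    exact ContinuousOn.rpow_const (by fun_prop) fun y hy => Or.inl (hpos y hy).ne'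
  rw [intervalIntegral.integral_eq_sub_of_hasDerivAt e hcont.intervalIntegrable]
  field_simp
  ring

/-- The exponent is -3 rather than the usual -2 because `dimIntegral` involves the s-derivative of
the product of propagators. -/
lemma hasDerivAt_propagators {A B s : ℝ} (k : ℝ) (hA : 0 < A + s) (hB : 0 < B + s) :
    HasDerivAt (fun s => k * (1 / (A + s)) * (1 / (B + s)))
      (-(k * ∫ y in (-1 : ℝ)..1, (((1 + y) * B + (1 - y) * A) / 2 + s) ^ (-3 : ℝ))) s := by
  have h1 : HasDerivAt (fun s : ℝ => k * (1 / (A + s))) (k * (-1 / (A + s) ^ 2)) s := by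
    simpa using (((hasDerivAt_id s).const_add A).inv hA.ne').const_mul k
  have h2 : HasDerivAt (fun s : ℝ => 1 / (B + s)) (-1 / (B + s) ^ 2) s := by
    simpa using ((hasDerivAt_id s).const_add B).fun_inv hB.ne'
  refine (h1.mul h2).congr_deriv ?_
  have e : ∀ y : ℝ, ((1 + y) * B + (1 - y) * A) / 2 + s =
      ((1 + y) * (B + s) + (1 - y) * (A + s)) / 2 := fun y => by ring
  simp only [e, integral_feynman_parameter hA hB]
  field_simp
  ring

/-- The integrand after Feynman parametrisation is integrable. -/
lemma integrable_feynman_kernel {D p M₁ M₂ : ℝ} (hD : 0 < D) (hD4 : D < 4) (h₁ : 0 < M₁)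
    (h₂ : 0 < M₂) {y : ℝ} (hy : y ∈ Icc (-1 : ℝ) 1) :
    Integrable (fun us : ℝ × ℝ => us.2 ^ ((D - 1) / 2) *
      (((1 + y) * ((us.1 + p) ^ 2 + M₂) + (1 - y) * (us.1 ^ 2 + M₁)) / 2 + us.2) ^ (-3 : ℝ))
      (volume.prod (volume.restrict (Ioi 0))) ∧
    ∫ us, us.2 ^ ((D - 1) / 2) *
      (((1 + y) * ((us.1 + p) ^ 2 + M₂) + (1 - y) * (us.1 ^ 2 + M₁)) / 2 + us.2) ^ (-3 : ℝ)
      ∂(volume.prod (volume.restrict (Ioi 0))) =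
    Real.Gamma ((D + 1) / 2) * √Real.pi * Real.Gamma (2 - D / 2) / 2 *
      feynDen p M₁ M₂ y ^ (-(2 - D / 2)) := by
  have hΔ := feynDen_pos p h₁ h₂ hy
  set Δ := feynDen p M₁ M₂ y with hΔdef
  -- Completing the square in u: a translation of u removes p from everything but Δ.
  have hL : ∀ u : ℝ, ((1 + y) * ((u + p) ^ 2 + M₂) + (1 - y) * (u ^ 2 + M₁)) / 2 =
      (u + (1 + y) * p / 2) ^ 2 + Δ := fun u => by
    rw [hΔdef, feynDen]; ring
  simp only [hL]
  have hα : 0 < (D + 1) / 2 := by linarith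
  have hαβ : (D + 1) / 2 < 3 := by linarith
  have hLpos : ∀ u : ℝ, 0 < (u + (1 + y) * p / 2) ^ 2 + Δ := fun u => by positivity
  have hexp : (D - 1) / 2 = (D + 1) / 2 - 1 := by ring
  have hin : ∀ u : ℝ, ∫ s in Ioi (0 : ℝ), s ^ ((D - 1) / 2) *
      ((u + (1 + y) * p / 2) ^ 2 + Δ + s) ^ (-3 : ℝ) =
      Real.Gamma ((D + 1) / 2) * Real.Gamma (3 - (D + 1) / 2) / 2 *
        ((u + (1 + y) * p / 2) ^ 2 + Δ) ^ (-(3 - (D + 1) / 2)) := fun u => by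
    rw [hexp, integral_rpow_mul_add_rpow hα hαβ (hLpos u),
      show Real.Gamma 3 = 2 by
        rw [show (3 : ℝ) = (2 : ℕ) + 1 by norm_num, Real.Gamma_nat_eq_factorial]
        norm_num [Nat.factorial], neg_sub]
    ring
  have hE : ((0 : ℕ) : ℝ) + 1 / 2 < 3 - (D + 1) / 2 := by push_cast; linarith
  obtain ⟨hi, hv⟩ := integrable_pow_mul_add_rpow 0 hΔ hE
  simp only [mul_zero, pow_zero, one_mul, Nat.cast_zero, zero_add] at hi hv
  have hint : Integrable (fun us : ℝ × ℝ => us.2 ^ ((D - 1) / 2) *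
      ((us.1 + (1 + y) * p / 2) ^ 2 + Δ + us.2) ^ (-3 : ℝ))
      (volume.prod (volume.restrict (Ioi 0))) := by
    rw [integrable_prod_iff (Measurable.aestronglyMeasurable (by fun_prop))]
    constructor
    · refine Eventually.of_forall fun u => ?_
      simp only [hexp]
      exact integrableOn_rpow_mul_add_rpow hα hαβ (hLpos u)
    · refine ((hi.comp_add_right ((1 + y) * p / 2)).const_mul
        (Real.Gamma ((D + 1) / 2) * Real.Gamma (3 - (D + 1) / 2) / 2)).congr ?_
      refine Eventually.of_forall fun u => ?_
      simp only [← hin]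
      refine setIntegral_congr_fun measurableSet_Ioi fun s hs => ?_
      have hs' : 0 < s := hs
      have := hLpos u
      rw [Real.norm_of_nonneg (by positivity)]
  refine ⟨hint, ?_⟩
  rw [integral_prod _ hint]
  simp only [hin]
  rw [integral_const_mul,
    integral_add_right_eq_self (fun u => (u ^ 2 + Δ) ^ (-(3 - (D + 1) / 2))) ((1 + y) * p / 2), hv,
    Real.Gamma_one_half_eq, show 3 - (D + 1) / 2 - 1 / 2 = 2 - D / 2 by ring,
    show 1 / 2 - (3 - (D + 1) / 2) = -(2 - D / 2) by ring]
  have := Real.Gamma_pos_of_pos (show 0 < 3 - (D + 1) / 2 by linarith)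
  generalize Real.Gamma (3 - (D + 1) / 2) = g at *
  generalize Real.Gamma (2 - D / 2) = g' at *
  field_simp

lemma continuousOn_feynDen_rpow {M₁ M₂ : ℝ} (p e : ℝ) (h₁ : 0 < M₁) (h₂ : 0 < M₂) :
    ContinuousOn (fun y => feynDen p M₁ M₂ y ^ e) (Icc (-1) 1) := by
  refine ContinuousOn.rpow_const ?_ fun y hy => Or.inl (feynDen_pos p h₁ h₂ hy).ne'
  unfold feynDen
  fun_prop

/-- The integrand of the bubble after Feynman parametrisation. -/
noncomputable def bubbleKernel (D p M₁ M₂ y : ℝ) (us : ℝ × ℝ) : ℝ :=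
  us.2 ^ ((D - 1) / 2) *
    (((1 + y) * ((us.1 + p) ^ 2 + M₂) + (1 - y) * (us.1 ^ 2 + M₁)) / 2 + us.2) ^ (-3 : ℝ)

/-- The kernel is nonnegative, and for fixed y its integral is a constant times a power of
`feynDen`, continuous in y. -/
lemma integrable_bubbleKernel {D M₁ M₂ : ℝ} (p : ℝ) (hD : 0 < D) (hD4 : D < 4) (h₁ : 0 < M₁)
    (h₂ : 0 < M₂) : Integrable (Function.uncurry (bubbleKernel D p M₁ M₂))
      ((volume.restrict (Ioc (-1) 1)).prod (volume.prod (volume.restrict (Ioi 0)))) := by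
  have hG := fun y (hy : y ∈ Icc (-1 : ℝ) 1) =>
    integrable_feynman_kernel (p := p) hD hD4 h₁ h₂ hy
  rw [integrable_prod_iff (Measurable.aestronglyMeasurable (by
    unfold Function.uncurry bubbleKernel; fun_prop))]
  constructor
  · filter_upwards [ae_restrict_mem measurableSet_Ioc] with y hy
    exact (hG y (Ioc_subset_Icc_self hy)).1
  · have hc := (continuousOn_feynDen_rpow p (-(2 - D / 2)) h₁ h₂).integrableOn_Icc (μ := volume)
    refine (((hc.mono_set Ioc_subset_Icc_self).const_mul (Real.Gamma ((D + 1) / 2) *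
      √Real.pi * Real.Gamma (2 - D / 2) / 2))).congr ?_
    filter_upwards [ae_restrict_mem measurableSet_Ioc] with y hy
    have hy' := Ioc_subset_Icc_self hy
    rw [← (hG y hy').2]
    refine integral_congr_ae ?_
    have : ∀ᵐ us : ℝ × ℝ ∂(volume.prod (volume.restrict (Ioi 0))), us.2 ∈ Ioi (0 : ℝ) :=
      Measure.quasiMeasurePreserving_snd.ae (ae_restrict_mem measurableSet_Ioi)
    filter_upwards [this] with us hus
    have hus' : 0 < us.2 := hus
    have hpos := feynDen_pos 0 (M₁ := us.1 ^ 2 + M₁) (M₂ := (us.1 + p) ^ 2 + M₂)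
      (by positivity) (by positivity) hy'
    simp only [feynDen, ne_eq, OfNat.ofNat_ne_zero, not_false_eq_true, zero_pow, mul_zero,
      zero_div, zero_add] at hpos
    simp only [Function.uncurry, bubbleKernel]
    rw [Real.norm_of_nonneg (by positivity)]

lemma rpow_mul_deriv_propagators {D M₁ M₂ s : ℝ} (p k u : ℝ) (h₁ : 0 < M₁) (h₂ : 0 < M₂)
    (hs : 0 < s) : s ^ ((D - 1) / 2) *
      deriv (fun s => k * (1 / (u ^ 2 + s + M₁)) * (1 / ((u + p) ^ 2 + s + M₂))) s =
      -k * ∫ y in Ioc (-1 : ℝ) 1, bubbleKernel D p M₁ M₂ y (u, s) := by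
  have hd := hasDerivAt_propagators (A := u ^ 2 + M₁) (B := (u + p) ^ 2 + M₂) (s := s) k
    (by positivity) (by positivity)
  have he : (fun s => k * (1 / (u ^ 2 + s + M₁)) * (1 / ((u + p) ^ 2 + s + M₂))) =
      fun s => k * (1 / (u ^ 2 + M₁ + s)) * (1 / ((u + p) ^ 2 + M₂ + s)) := by
    funext s
    rw [add_right_comm (u ^ 2), add_right_comm ((u + p) ^ 2)]
  rw [he, hd.deriv, ← intervalIntegral.integral_of_le (by norm_num)]
  simp only [bubbleKernel, intervalIntegral.integral_const_mul]
  ring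

lemma integrable_rpow_mul_deriv_propagators {D M₁ M₂ : ℝ} (p k : ℝ) (hD : 0 < D) (hD4 : D < 4)
    (h₁ : 0 < M₁) (h₂ : 0 < M₂) :
    Integrable (fun z : ℝ × ℝ => z.2 ^ ((D - 1) / 2) *
      deriv (fun s => k * (1 / (z.1 ^ 2 + s + M₁)) * (1 / ((z.1 + p) ^ 2 + s + M₂))) z.2)
      (volume.prod (volume.restrict (Ioi 0))) := by
  refine ((integrable_bubbleKernel p hD hD4 h₁ h₂).integral_prod_right.const_mul (-k)).congr ?_
  have : ∀ᵐ us : ℝ × ℝ ∂(volume.prod (volume.restrict (Ioi 0))), us.2 ∈ Ioi (0 : ℝ) :=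
    Measure.quasiMeasurePreserving_snd.ae (ae_restrict_mem measurableSet_Ioi)
  filter_upwards [this] with z hz
  exact (rpow_mul_deriv_propagators p k z.1 h₁ h₂ hz).symm

/-- Feynman-parameter representation of the bubble in real dimension `D`. -/
lemma innerIntegral_eq {D m₁ m₂ : ℝ} (p : ℝ) (hD : 0 < D) (hD4 : D < 4) (h₁ : 0 < m₁)
    (h₂ : 0 < m₂) :
    innerIntegral D p m₁ m₂ = Real.Gamma (2 - D / 2) / (2 * (4 * Real.pi) ^ (D / 2)) *
      ∫ y in (-1 : ℝ)..1, feynDen p (m₁ ^ 2) (m₂ ^ 2) y ^ (-(2 - D / 2)) := by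
  have hM₁ : 0 < m₁ ^ 2 := by positivity
  have hM₂ : 0 < m₂ ^ 2 := by positivity
  have hGint := integrable_bubbleKernel p hD hD4 hM₁ hM₂
  have hsection : ∀ u : ℝ, ∀ s ∈ Ioi (0 : ℝ), s ^ ((D - 1) / 2) *
      deriv (fun s => 1 / (2 * Real.pi) ^ D * (1 / (u ^ 2 + s + m₁ ^ 2)) *
        (1 / ((u + p) ^ 2 + s + m₂ ^ 2))) s =
      -(1 / (2 * Real.pi) ^ D) * ∫ y in Ioc (-1 : ℝ) 1, bubbleKernel D p (m₁ ^ 2) (m₂ ^ 2) y (u, s) :=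
    fun u _ hs => rpow_mul_deriv_propagators p _ u hM₁ hM₂ hs
  have hswap : ∫ u : ℝ, ∫ s in Ioi (0 : ℝ), ∫ y in Ioc (-1 : ℝ) 1, bubbleKernel D p (m₁ ^ 2) (m₂ ^ 2) y (u, s) =
      Real.Gamma ((D + 1) / 2) * √Real.pi * Real.Gamma (2 - D / 2) / 2 *
      ∫ y in (-1 : ℝ)..1, feynDen p (m₁ ^ 2) (m₂ ^ 2) y ^ (-(2 - D / 2)) := by
    rw [← intervalIntegral.integral_const_mul, intervalIntegral.integral_of_le (by norm_num),
      ← setIntegral_congr_fun measurableSet_Ioc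
        (fun y hy => (integrable_feynman_kernel (p := p) hD hD4 hM₁ hM₂
          (Ioc_subset_Icc_self hy)).2)]
    exact (integral_prod _ hGint.integral_prod_right).symm.trans (integral_integral_swap hGint).symm
  unfold innerIntegral dimIntegral
  simp_rw [setIntegral_congr_fun measurableSet_Ioi (hsection _), integral_const_mul]
  rw [hswap]
  have hGa := Real.Gamma_pos_of_pos (show 0 < (D + 1) / 2 by linarith)
  have e1 : (2 * Real.pi) ^ D = (4 * Real.pi) ^ (D / 2) * Real.pi ^ (D / 2) := by
    rw [← Real.mul_rpow (by positivity) (by positivity),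
      show 4 * Real.pi * Real.pi = (2 * Real.pi) ^ (2 : ℝ) by norm_num; ring,
      ← Real.rpow_mul (by positivity)]
    congr 1; ring
  have e2 : Real.pi ^ (D / 2) = Real.pi ^ ((D - 1) / 2) * √Real.pi := by
    rw [Real.sqrt_eq_rpow, ← Real.rpow_add Real.pi_pos]; congr 1; ring
  rw [e1, e2]
  have : 0 < √Real.pi := Real.sqrt_pos.2 Real.pi_pos
  field_simp

/-! ### The momentum integral over the second set of variables -/

lemma integrable_and_hasSum_integral {Ω : Type*} [MeasurableSpace Ω] {μ : Measure Ω}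
    {F : ℕ → Ω → ℝ} {f : Ω → ℝ} (hF : ∀ n, Integrable (F n) μ)
    (hs : Summable fun n => ∫ x, ‖F n x‖ ∂μ) (hf : AEStronglyMeasurable f μ)
    (h : ∀ᵐ x ∂μ, HasSum (fun n => F n x) (f x)) :
    Integrable f μ ∧ HasSum (fun n => ∫ x, F n x ∂μ) (∫ x, f x ∂μ) := by
  constructor
  · refine ⟨hf, ?_⟩
    have h1 : ∫⁻ x, ‖f x‖ₑ ∂μ ≤ ∫⁻ x, ∑' n, ‖F n x‖ₑ ∂μ := by
      refine lintegral_mono_ae ?_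
      filter_upwards [h] with x hx
      rw [← hx.tsum_eq]
      exact enorm_tsum_le_tsum_enorm
    refine lt_of_le_of_lt h1 ?_
    rw [lintegral_tsum fun n => (hF n).1.enorm]
    have h2 : ∀ n, ∫⁻ x, ‖F n x‖ₑ ∂μ = ENNReal.ofReal (∫ x, ‖F n x‖ ∂μ) := fun n =>
      (ofReal_integral_norm_eq_lintegral_enorm (hF n)).symm
    simp_rw [h2]
    rw [← ENNReal.ofReal_tsum_of_nonneg (fun n => integral_nonneg fun _ => norm_nonneg _) hs]
    exact ENNReal.ofReal_lt_top
  · have h1 := hasSum_integral_of_summable_integral_norm hF hs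
    rwa [integral_congr_ae (h.mono fun x hx => hx.tsum_eq)] at h1

/-- The two differences S ± w are the shifted masses (v ± q/2)² + t. -/
lemma abs_mul_lt_add_sq {v t q : ℝ} (ht : 0 < t) : |v * q| < v ^ 2 + t + q ^ 2 / 4 := by
  rw [abs_lt]
  constructor <;> nlinarith [sq_nonneg (v - q / 2), sq_nonneg (v + q / 2)]

/-- One term of the expansion, integrated over the whole space. -/
lemma integrable_expansion_term {D m q : ℝ} (hm : 0 < m) (ha : 0 < parA D m)
    (hq : 0 < q) (r n : ℕ) :
    Integrable (fun vt : ℝ × ℝ => vt.2 ^ ((m - 1) / 2) * ((vt.1 * q) ^ (2 * n) *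
      (vt.1 ^ 2 + vt.2 + q ^ 2 / 4) ^ (-(2 * (2 - D / 2 + r) + 2 * n + 1))))
      (volume.prod (volume.restrict (Ioi 0))) ∧
    ∫ vt, vt.2 ^ ((m - 1) / 2) * ((vt.1 * q) ^ (2 * n) *
      (vt.1 ^ 2 + vt.2 + q ^ 2 / 4) ^ (-(2 * (2 - D / 2 + r) + 2 * n + 1)))
      ∂(volume.prod (volume.restrict (Ioi 0))) =
    q ^ (2 * n) * (q ^ 2 / 4) ^ (-(parA D m + 2 * r + n)) *
      (Real.Gamma ((m + 1) / 2) * Real.Gamma (n + 1 / 2) * Real.Gamma (parA D m + 2 * r + n) /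
        Real.Gamma (2 * (2 - D / 2 + r) + 2 * n + 1)) := by
  set β := 2 * (2 - D / 2 + r) + 2 * n + 1 with hβ
  set E := β - (m + 1) / 2 with hE
  have hh : 0 < q ^ 2 / 4 := by positivity
  have hα : 0 < (m + 1) / 2 := by linarith
  have hr : (0 : ℝ) ≤ r := Nat.cast_nonneg r
  have hn : (0 : ℝ) ≤ n := Nat.cast_nonneg n
  have hE1 : E - (n + 1 / 2) = parA D m + 2 * r + n := by rw [hE, hβ, parA]; ring
  have hEn : n + 1 / 2 < E := by
    have : 0 < E - (n + 1 / 2) := by rw [hE1]; positivity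
    linarith
  have hαβ : (m + 1) / 2 < β := by
    have : 0 < E := lt_trans (by positivity) hEn
    linarith
  have hexp : (m - 1) / 2 = (m + 1) / 2 - 1 := by ring
  obtain ⟨hi, hv⟩ := integrable_pow_mul_add_rpow n hh hEn
  have hL : ∀ v : ℝ, 0 < v ^ 2 + q ^ 2 / 4 := fun v => by positivity
  have hin : ∀ v : ℝ, ∫ t in Ioi (0 : ℝ), t ^ ((m - 1) / 2) * ((v * q) ^ (2 * n) *
      (v ^ 2 + t + q ^ 2 / 4) ^ (-β)) =
      q ^ (2 * n) * (Real.Gamma ((m + 1) / 2) * Real.Gamma E / Real.Gamma β) *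
        (v ^ (2 * n) * (v ^ 2 + q ^ 2 / 4) ^ (-E)) := fun v => by
    have h1 := integral_rpow_mul_add_rpow hα hαβ (hL v)
    have h2 : ∀ t : ℝ, t ^ ((m - 1) / 2) * ((v * q) ^ (2 * n) *
      (v ^ 2 + t + q ^ 2 / 4) ^ (-β)) =
        (v * q) ^ (2 * n) * (t ^ ((m + 1) / 2 - 1) * (v ^ 2 + q ^ 2 / 4 + t) ^ (-β)) := fun t => by
      rw [hexp, add_right_comm]; ring
    simp_rw [h2]
    rw [integral_const_mul, h1, mul_pow, hE, neg_sub]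
    ring
  have hint : Integrable (fun vt : ℝ × ℝ => vt.2 ^ ((m - 1) / 2) * ((vt.1 * q) ^ (2 * n) *
      (vt.1 ^ 2 + vt.2 + q ^ 2 / 4) ^ (-β))) (volume.prod (volume.restrict (Ioi 0))) := by
    rw [integrable_prod_iff (Measurable.aestronglyMeasurable (by fun_prop))]
    constructor
    · refine Eventually.of_forall fun v => ?_
      refine ((integrableOn_rpow_mul_add_rpow hα hαβ (hL v)).const_mul ((v * q) ^ (2 * n))).congr
        (Eventually.of_forall fun t => ?_)
      simp only [hexp]
      rw [add_right_comm (v ^ 2)]; ring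
    · refine (hi.const_mul (q ^ (2 * n) *
        (Real.Gamma ((m + 1) / 2) * Real.Gamma E / Real.Gamma β))).congr ?_
      refine Eventually.of_forall fun v => ?_
      simp only [← hin]
      refine setIntegral_congr_fun measurableSet_Ioi fun t ht => ?_
      have ht' : 0 < t := ht
      have h0 : 0 ≤ (v * q) ^ (2 * n) := by rw [pow_mul]; positivity
      rw [Real.norm_of_nonneg (by positivity)]
  refine ⟨hint, ?_⟩
  rw [integral_prod _ hint]
  simp only [hin]
  rw [integral_const_mul, hv, hE1, show (n : ℝ) + 1 / 2 - E = -(parA D m + 2 * r + n) by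
    rw [← hE1]; ring]
  have : 0 < Real.Gamma E := Real.Gamma_pos_of_pos (lt_trans (by positivity) hEn)
  field_simp

/-- The integrand of the `r`-th moment at the point `((v, t), y)`. -/
noncomputable def momentKernel (D m q : ℝ) (r : ℕ) (ω : (ℝ × ℝ) × ℝ) : ℝ :=
  ω.1.2 ^ ((m - 1) / 2) * ((1 - ω.2 ^ 2) ^ r *
    ((2 * (ω.1.1 ^ 2 + ω.1.2 + q ^ 2 / 4) + 2 * ω.2 * (ω.1.1 * q)) * (2 - D / 2 + r) *
      ((ω.1.1 ^ 2 + ω.1.2 + q ^ 2 / 4) ^ 2 + (ω.1.1 * q) ^ 2 +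
        2 * ω.2 * (ω.1.1 ^ 2 + ω.1.2 + q ^ 2 / 4) * (ω.1.1 * q)) ^ (-(2 - D / 2 + r) - 1)))

/-- The measure on the space of `((v, t), y)`. -/
noncomputable abbrev paramMeasure : Measure ((ℝ × ℝ) × ℝ) :=
  (volume.prod (volume.restrict (Ioi 0))).prod (volume.restrict (Ioc (-1) 1))

lemma ae_snd_pos : ∀ᵐ vt : ℝ × ℝ ∂(volume.prod (volume.restrict (Ioi 0))), 0 < vt.2 :=
  Measure.quasiMeasurePreserving_snd.ae (ae_restrict_mem measurableSet_Ioi)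

lemma ae_paramMeasure : ∀ᵐ ω ∂paramMeasure, 0 < ω.1.2 ∧ ω.2 ∈ Icc (-1 : ℝ) 1 := by
  have h1 : ∀ᵐ ω ∂paramMeasure, 0 < ω.1.2 := Measure.quasiMeasurePreserving_fst.ae ae_snd_pos
  have h2 : ∀ᵐ ω ∂paramMeasure, ω.2 ∈ Ioc (-1 : ℝ) 1 :=
    Measure.quasiMeasurePreserving_snd.ae (ae_restrict_mem measurableSet_Ioc)
  filter_upwards [h1, h2] with ω h1 h2 using ⟨h1, Ioc_subset_Icc_self h2⟩

lemma measurable_momentKernel (D m q : ℝ) (r : ℕ) : Measurable (momentKernel D m q r) := by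
  unfold momentKernel
  fun_prop

lemma two_mul_add_nonneg {S w y : ℝ} (hw : |w| < S) (hy : y ∈ Icc (-1 : ℝ) 1) :
    0 ≤ 2 * S + 2 * y * w := by
  have h1 : |y * w| ≤ |w| := by
    rw [abs_mul]; exact mul_le_of_le_one_left (abs_nonneg w) (abs_le.2 hy)
  have := (abs_le.1 (h1.trans hw.le)).1
  linarith

lemma momentKernel_nonneg {D m q : ℝ} (hD4 : D < 4) (r : ℕ) {ω : (ℝ × ℝ) × ℝ} (ht : 0 < ω.1.2)
    (hy : ω.2 ∈ Icc (-1 : ℝ) 1) : 0 ≤ momentKernel D m q r ω := by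
  have hw := abs_mul_lt_add_sq (v := ω.1.1) (q := q) ht
  have h1 := sq_add_sq_add_pos hw hy
  have h2 := two_mul_add_nonneg hw hy
  have h3 : 0 ≤ 1 - ω.2 ^ 2 := by nlinarith [hy.1, hy.2]
  have h4 : 0 < 2 - D / 2 + r := by
    have : (0 : ℝ) ≤ r := Nat.cast_nonneg r
    linarith
  unfold momentKernel
  positivity

lemma continuousOn_momentKernel {D m q : ℝ} (r : ℕ) {v t : ℝ} (ht : 0 < t) :
    ContinuousOn (fun y => momentKernel D m q r ((v, t), y)) (Icc (-1) 1) := by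
  have hw := abs_mul_lt_add_sq (v := v) (q := q) ht
  have h : ContinuousOn (fun y : ℝ => ((v ^ 2 + t + q ^ 2 / 4) ^ 2 + (v * q) ^ 2 +
      2 * y * (v ^ 2 + t + q ^ 2 / 4) * (v * q)) ^ (-(2 - D / 2 + r) - 1)) (Icc (-1) 1) :=
    ContinuousOn.rpow_const (by fun_prop) fun y hy => Or.inl (sq_add_sq_add_pos hw hy).ne'
  simp only [momentKernel]
  fun_prop

/-- The normalisation of the moments. -/
noncomputable def momentNorm (D m q : ℝ) : ℝ :=
  2 * (q ^ 2 / 4) ^ (-parA D m) * (Real.Gamma ((m + 1) / 2) * √Real.pi * Real.Gamma (parA D m) /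
    Real.Gamma (2 * (2 - D / 2)))

lemma integral_momentKernel {D m q : ℝ} (hm : 0 < m) (hD4 : D < 4)
    (ha : 0 < parA D m) (ha2 : parA D m < 2) (hq : 0 < q) (r : ℕ) :
    Integrable (momentKernel D m q r) paramMeasure ∧
    poch (2 - D / 2) r * (q ^ 4 / 16) ^ r / r.factorial * ∫ ω, momentKernel D m q r ω ∂paramMeasure =
      momentNorm D m q * (coeffC D m r * coeffF D m r) := by
  set c := 2 - D / 2 with hc
  have hc0 : 0 < c := by linarith
  have hl : 0 < c + r := by positivity
  have hbc : c + r - r - 1 / 2 = parB D := by rw [hc, parB]; ring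
  have hb1 : 0 < parB D + 1 := by rw [parB]; linarith
  set μ : Measure (ℝ × ℝ) := volume.prod (volume.restrict (Ioi 0)) with hμ
  set κ : ℝ := 2 * r.factorial / poch (3 / 2) r with hκ
  have p32 := poch_pos (x := 3 / 2) (by norm_num) r
  let K : ℕ → ℝ := fun n => hyp21Coeff (c + r) (parB D) (r + 3 / 2) n
  let F : ℕ → ℝ × ℝ → ℝ := fun n vt => κ * (K n * (2 * (c + r) + 2 * n)) *
    (vt.2 ^ ((m - 1) / 2) * ((vt.1 * q) ^ (2 * n) *
      (vt.1 ^ 2 + vt.2 + q ^ 2 / 4) ^ (-(2 * (c + r) + 2 * n + 1))))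
  let H : ℝ × ℝ → ℝ := fun vt => ∫ y in Ioc (-1 : ℝ) 1, momentKernel D m q r (vt, y)
  have hsm : Summable (hyp32Term (parA D m + 2 * r) (1 / 2) (parB D) (3 / 2 + r)
      (parB D + 1 + r) 1) :=
    hyp32Term_one_summable (by positivity) (by norm_num) hb1 (by positivity) (by positivity)
      (by linarith)
  have hterm := integrable_expansion_term (D := D) hm ha hq r
  rw [← hc] at hterm
  have hFval : ∀ n, poch c r * (q ^ 4 / 16) ^ r / r.factorial * ∫ vt, F n vt ∂μ =
      momentNorm D m q * (coeffC D m r * hyp32Term (parA D m + 2 * r) (1 / 2) (parB D) (3 / 2 + r)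
        (parB D + 1 + r) 1 n) := by
    intro n
    simp only [F]
    rw [integral_const_mul, (hterm n).2]
    have hcn : 0 < 2 * (c + r) + 2 * (n : ℝ) := by positivity
    have g1 : Real.Gamma (n + 1 / 2) = poch (1 / 2) n * √Real.pi := by
      rw [add_comm, Gamma_add_nat (by norm_num), Real.Gamma_one_half_eq]
    have g2 : Real.Gamma (parA D m + 2 * r + n) =
        poch (parA D m) (2 * r) * poch (parA D m + 2 * r) n * Real.Gamma (parA D m) := by
      rw [Gamma_add_nat (by positivity), show parA D m + 2 * (r : ℝ) = parA D m + (2 * r : ℕ) by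
        push_cast; ring, Gamma_add_nat ha]; ring
    -- The factor 2(c+r) + 2n split off here cancels the one created by the S-derivative.
    -- Duplication then yields (c)_(r+n), whose part (c+r)_n cancels the numerator of the ₂F₁
    -- coefficient, and (b+1)_(r+n), which supplies the lower parameters of C_r and F_r.
    have g3 : Real.Gamma (2 * (c + r) + 2 * n + 1) = (2 * (c + r) + 2 * n) *
        (4 ^ (r + n) * (poch c r * poch (c + r) n) *
          (poch (parB D + 1) r * poch (parB D + 1 + r) n) * Real.Gamma (2 * c)) := by
      rw [Real.Gamma_add_one hcn.ne', show 2 * (c + r) + 2 * (n : ℝ) = 2 * c + (2 * (r + n) : ℕ) by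
        push_cast; ring, Gamma_add_nat (by positivity), poch_two_mul,
        show c + 1 / 2 = parB D + 1 by rw [hc, parB]; ring, poch_add, poch_add]
    have g4 : (q ^ 2 / 4) ^ (-(parA D m + 2 * r + n)) =
        (q ^ 2 / 4) ^ (-parA D m) * ((q ^ 2 / 4) ^ (2 * r + n))⁻¹ := by
      rw [← Real.rpow_natCast (q ^ 2 / 4) (2 * r + n), ← Real.rpow_neg (by positivity),
        ← Real.rpow_add (by positivity)]
      congr 1; push_cast; ring
    have g5 : (q ^ 4 / 16) ^ r = (q ^ 2 / 4) ^ (2 * r) := by rw [pow_mul]; congr 1; ring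
    have g6 : q ^ (2 * n) = 4 ^ n * (q ^ 2 / 4) ^ n := by rw [pow_mul, ← mul_pow]; congr 1; ring
    rw [g1, g2, g3, g4, g5, g6, momentNorm, coeffC, hyp32Term, ← hc]
    simp only [K, hκ, hyp21Coeff, one_pow]
    have p1 := poch_ne_zero hc0 r
    have p2 := poch_ne_zero hl n
    have p3 := poch_ne_zero hb1 r
    have p4 := poch_ne_zero (x := parB D + 1 + r) (by positivity) n
    have p5 := poch_ne_zero (x := r + 3 / 2) (by positivity) n
    have p6 := (Real.Gamma_pos_of_pos (show 0 < 2 * c by positivity)).ne'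
    have hz : q ^ 2 / 4 ≠ 0 := by positivity
    generalize (q ^ 2 / 4) ^ (-parA D m) = Q
    generalize q ^ 2 / 4 = z at *
    rw [add_comm (3 / 2 : ℝ) r]
    field_simp
    ring
  have hFint : ∀ n, Integrable (F n) μ := fun n => (hterm n).1.const_mul _
  have hpref : 0 < poch c r * (q ^ 4 / 16) ^ r / r.factorial := by
    have := poch_pos hc0 r
    positivity
  -- Each F n is a constant times a nonnegative function, so ∫ |F n| = |∫ F n|, which is a multiple
  -- of the absolute value of a summable ₃F₂ term.
  have hFnorm : Summable fun n => ∫ vt, ‖F n vt‖ ∂μ := by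
    refine (((hsm.mul_left (coeffC D m r)).mul_left (momentNorm D m q)).abs.mul_left
      (poch c r * (q ^ 4 / 16) ^ r / r.factorial)⁻¹).congr fun n => ?_
    rw [← hFval, abs_mul, abs_of_pos hpref, inv_mul_cancel_left₀ hpref.ne']
    simp only [F, norm_mul (κ * (K n * (2 * (c + r) + 2 * n)))]
    rw [integral_const_mul, integral_const_mul, abs_mul, ← Real.norm_eq_abs]
    congr 1
    have hpos : ∀ᵐ vt ∂μ, 0 ≤ vt.2 ^ ((m - 1) / 2) * ((vt.1 * q) ^ (2 * n) *
        (vt.1 ^ 2 + vt.2 + q ^ 2 / 4) ^ (-(2 * (c + r) + 2 * (n : ℝ) + 1))) := by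
      filter_upwards [ae_snd_pos] with vt ht
      have h0 : 0 ≤ (vt.1 * q) ^ (2 * n) := by rw [pow_mul]; positivity
      positivity
    rw [abs_of_nonneg (integral_nonneg_of_ae hpos)]
    refine integral_congr_ae (hpos.mono fun vt h => ?_)
    simp only [Real.norm_of_nonneg h]
  have hHS : ∀ᵐ vt ∂μ, HasSum (fun n => F n vt) (H vt) := by
    filter_upwards [ae_snd_pos] with vt ht
    have h1 := hasSum_integral_gegenbauer_deriv r hl (by rw [hbc]; exact hb1)
      (abs_mul_lt_add_sq (v := vt.1) (q := q) ht)
    rw [hbc] at h1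
    refine hasSum_of_eq (h1.mul_left (vt.2 ^ ((m - 1) / 2))) (fun n => ?_) ?_
    · simp only [F, K]; ring
    · simp only [H, momentKernel, ← hc]
      rw [← intervalIntegral.integral_of_le (by norm_num), intervalIntegral.integral_const_mul]
  have hmeas : AEStronglyMeasurable H μ :=
    ((measurable_momentKernel D m q r).stronglyMeasurable.integral_prod_right').aestronglyMeasurable
  obtain ⟨hHi, hHs⟩ := integrable_and_hasSum_integral hFint hFnorm hmeas hHS
  -- The kernel is nonnegative, so integrability of its y-integral H gives integrability in all
  -- variables.
  have hint : Integrable (momentKernel D m q r) paramMeasure := by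
    rw [integrable_prod_iff (measurable_momentKernel D m q r).aestronglyMeasurable]
    constructor
    · filter_upwards [ae_snd_pos] with vt ht
      exact (continuousOn_momentKernel r ht).integrableOn_Icc.mono_set Ioc_subset_Icc_self
    · refine hHi.congr ?_
      filter_upwards [ae_snd_pos] with vt ht
      refine setIntegral_congr_fun measurableSet_Ioc fun y hy => ?_
      rw [Real.norm_of_nonneg (momentKernel_nonneg hD4 r ht (Ioc_subset_Icc_self hy))]
  refine ⟨hint, ?_⟩
  rw [integral_prod _ hint]
  have h1 := hHs.mul_left (poch c r * (q ^ 4 / 16) ^ r / r.factorial)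
  simp only [hFval] at h1
  rw [← h1.tsum_eq, tsum_mul_left, tsum_mul_left]
  rfl

/-! ### Parametric representation of the Feynman integral and its moments -/

/-- The derivative of the bubble with respect to the transverse variable `t`. -/
lemma hasDerivAt_innerIntegral {D v t : ℝ} (p q : ℝ) (hD : 0 < D) (hD4 : D < 4)
    (h₁ : 0 < v ^ 2 + t) (h₂ : 0 < (v + q) ^ 2 + t) :
    HasDerivAt (fun t => innerIntegral D p (v ^ 2 + t) ((v + q) ^ 2 + t))
      (-(Real.Gamma (2 - D / 2) / (2 * (4 * Real.pi) ^ (D / 2)) *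
        ∫ y in (-1 : ℝ)..1, ((1 + y) * ((v + q) ^ 2 + t) + (1 - y) * (v ^ 2 + t)) * (2 - D / 2) *
          feynDen p ((v ^ 2 + t) ^ 2) (((v + q) ^ 2 + t) ^ 2) y ^ (-(2 - D / 2) - 1))) t := by
  set U : Set ℝ := {t | 0 < v ^ 2 + t ∧ 0 < (v + q) ^ 2 + t} with hU
  have hUo : IsOpen U := by
    refine IsOpen.inter ?_ ?_
    · exact isOpen_lt (g := fun t => v ^ 2 + t) continuous_const (by fun_prop)
    · exact isOpen_lt (g := fun t => (v + q) ^ 2 + t) continuous_const (by fun_prop)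
  have hne : ∀ x ∈ U ×ˢ Icc (-1 : ℝ) 1,
      feynDen p ((v ^ 2 + x.1) ^ 2) (((v + q) ^ 2 + x.1) ^ 2) x.2 ≠ 0 := fun x hx =>
    (feynDen_pos p (pow_pos hx.1.1 2) (pow_pos hx.1.2 2) hx.2).ne'
  have hden : Continuous fun x : ℝ × ℝ =>
      feynDen p ((v ^ 2 + x.1) ^ 2) (((v + q) ^ 2 + x.1) ^ 2) x.2 := by
    unfold feynDen; fun_prop
  have hd := hasDerivAt_integral_of_continuousOn hUo (by norm_num : (-1 : ℝ) ≤ 1)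
    (F := fun t y => feynDen p ((v ^ 2 + t) ^ 2) (((v + q) ^ 2 + t) ^ 2) y ^ (-(2 - D / 2)))
    (F' := fun t y => -(((1 + y) * ((v + q) ^ 2 + t) + (1 - y) * (v ^ 2 + t)) * (2 - D / 2) *
          feynDen p ((v ^ 2 + t) ^ 2) (((v + q) ^ 2 + t) ^ 2) y ^ (-(2 - D / 2) - 1)))
    (hden.continuousOn.rpow_const fun x hx => Or.inl (hne x hx))
    (ContinuousOn.neg (ContinuousOn.mul (by fun_prop)
      (hden.continuousOn.rpow_const fun x hx => Or.inl (hne x hx))))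
    (fun t ht y hy => by
      have h1 : HasDerivAt (fun t : ℝ => (v ^ 2 + t) ^ 2) (2 * (v ^ 2 + t)) t := by
        refine (((hasDerivAt_id t).const_add (v ^ 2)).pow 2).congr_deriv ?_
        simp
      have h2 : HasDerivAt (fun t : ℝ => ((v + q) ^ 2 + t) ^ 2) (2 * ((v + q) ^ 2 + t)) t := by
        refine (((hasDerivAt_id t).const_add ((v + q) ^ 2)).pow 2).congr_deriv ?_
        simp
      have h3 : HasDerivAt (fun t : ℝ => feynDen p ((v ^ 2 + t) ^ 2) (((v + q) ^ 2 + t) ^ 2) y)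
          ((1 + y) * ((v + q) ^ 2 + t) + (1 - y) * (v ^ 2 + t)) t := by
        refine ((((h2.const_mul (1 + y)).add (h1.const_mul (1 - y))).div_const 2).const_add
          ((1 - y ^ 2) * p ^ 2 / 4)).congr_deriv ?_
        ring
      refine (h3.rpow_const (Or.inl (hne (t, y) ⟨ht, hy⟩))).congr_deriv ?_
      ring) (show t ∈ U from ⟨h₁, h₂⟩)
  rw [intervalIntegral.integral_neg] at hd
  refine ((hd.const_mul _).congr_deriv (mul_neg _ _)).congr_of_eventuallyEq ?_
  filter_upwards [hUo.mem_nhds (show t ∈ U from ⟨h₁, h₂⟩)] with s hs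
  exact innerIntegral_eq p hD hD4 hs.1 hs.2

/-- The common denominator at vanishing longitudinal momentum. -/
noncomputable def massDen (q : ℝ) (ω : (ℝ × ℝ) × ℝ) : ℝ :=
  (ω.1.1 ^ 2 + ω.1.2 + q ^ 2 / 4) ^ 2 + (ω.1.1 * q) ^ 2 +
    2 * ω.2 * (ω.1.1 ^ 2 + ω.1.2 + q ^ 2 / 4) * (ω.1.1 * q)

lemma massDen_pos {q : ℝ} {ω : (ℝ × ℝ) × ℝ} (ht : 0 < ω.1.2) (hy : ω.2 ∈ Icc (-1 : ℝ) 1) :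
    0 < massDen q ω :=
  sq_add_sq_add_pos (abs_mul_lt_add_sq ht) hy

/-- The ratio variable, with values in `[0, 1]`, through which the integrand depends on `X`. -/
noncomputable def tauVar (q : ℝ) (ω : (ℝ × ℝ) × ℝ) : ℝ :=
  (1 - ω.2 ^ 2) * q ^ 4 / (16 * massDen q ω)

lemma measurable_tauVar (q : ℝ) : Measurable (tauVar q) := by
  unfold tauVar massDen
  fun_prop

lemma tauVar_mem {q : ℝ} {ω : (ℝ × ℝ) × ℝ} (ht : 0 < ω.1.2) (hy : ω.2 ∈ Icc (-1 : ℝ) 1) :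
    tauVar q ω ∈ Icc (0 : ℝ) 1 := by
  have hM := massDen_pos (q := q) ht hy
  have hy2 : 0 ≤ 1 - ω.2 ^ 2 := by nlinarith [hy.1, hy.2]
  refine ⟨by unfold tauVar; positivity, ?_⟩
  rw [tauVar, div_le_one (by positivity)]
  -- The denominator equals (yS + w)² + (1 - y²) S², and S ≥ q²/4.
  have hS : (q ^ 2 / 4) ^ 2 ≤ (ω.1.1 ^ 2 + ω.1.2 + q ^ 2 / 4) ^ 2 :=
    pow_le_pow_left₀ (by positivity) (by nlinarith [sq_nonneg ω.1.1]) 2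
  have h1 : (1 - ω.2 ^ 2) * (q ^ 2 / 4) ^ 2 ≤
      (1 - ω.2 ^ 2) * (ω.1.1 ^ 2 + ω.1.2 + q ^ 2 / 4) ^ 2 := mul_le_mul_of_nonneg_left hS hy2
  have h2 := sq_nonneg (ω.2 * (ω.1.1 ^ 2 + ω.1.2 + q ^ 2 / 4) + ω.1.1 * q)
  unfold massDen
  nlinarith

/-- After the shift the masses are S - w and S + w, whose weighted mean square is `massDen`; the
momentum p survives only through X. -/
lemma feynDen_eq {p q v t y : ℝ} (hq : 0 < q) (ht : 0 < t) (hy : y ∈ Icc (-1 : ℝ) 1) :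
    feynDen p (((v - q / 2) ^ 2 + t) ^ 2) (((v - q / 2 + q) ^ 2 + t) ^ 2) y =
      massDen q ((v, t), y) * (1 + parX p q * tauVar q ((v, t), y)) := by
  have hM := massDen_pos (q := q) (ω := ((v, t), y)) ht hy
  have e1 : (1 - y ^ 2) * p ^ 2 / 4 = massDen q ((v, t), y) *
      (parX p q * tauVar q ((v, t), y)) := by
    simp only [parX, tauVar]
    field_simp
    ring
  rw [mul_add, ← e1]
  simp only [feynDen, massDen]
  ring

lemma parX_pos {p q : ℝ} (hp : 0 < p) (hq : 0 < q) : 0 < parX p q := by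
  unfold parX; positivity

lemma feynDen_kernel {D m p q v t y : ℝ} (hp : 0 < p) (hq : 0 < q) (ht : 0 < t)
    (hy : y ∈ Icc (-1 : ℝ) 1) :
    t ^ ((m - 1) / 2) * (((1 + y) * ((v - q / 2 + q) ^ 2 + t) + (1 - y) * ((v - q / 2) ^ 2 + t)) *
      (2 - D / 2) * feynDen p (((v - q / 2) ^ 2 + t) ^ 2) (((v - q / 2 + q) ^ 2 + t) ^ 2) y ^
        (-(2 - D / 2) - 1)) =
    momentKernel D m q 0 ((v, t), y) *
      (1 + parX p q * tauVar q ((v, t), y)) ^ (-(2 - D / 2 + 1)) := by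
  have hM := massDen_pos (q := q) (ω := ((v, t), y)) ht hy
  have hτ := (tauVar_mem (q := q) (ω := ((v, t), y)) ht hy).1
  have hX := parX_pos hp hq
  rw [feynDen_eq hq ht hy, Real.mul_rpow hM.le (by positivity)]
  simp only [momentKernel, massDen, pow_zero, one_mul, Nat.cast_zero, add_zero]
  rw [neg_add']
  ring

lemma integrable_momentKernel_mul {D m p q : ℝ} (hm : 0 < m) (hD4 : D < 4)
    (ha : 0 < parA D m) (ha2 : parA D m < 2) (hp : 0 < p) (hq : 0 < q) :
    Integrable (fun ω => momentKernel D m q 0 ω *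
      (1 + parX p q * tauVar q ω) ^ (-(2 - D / 2 + 1))) paramMeasure := by
  have hX := parX_pos hp hq
  refine (integral_momentKernel hm hD4 ha ha2 hq 0).1.mul_bdd (c := 1)
    (Measurable.aestronglyMeasurable (by have := measurable_tauVar q; fun_prop)) ?_
  filter_upwards [ae_paramMeasure] with ω hω
  have hτ := (tauVar_mem (q := q) hω.1 hω.2).1
  rw [Real.norm_of_nonneg (by positivity)]
  exact Real.rpow_le_one_of_one_le_of_nonpos (by linarith [mul_nonneg hX.le hτ]) (by linarith)

/-- The constant in front of the parametric representation. -/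
noncomputable def feynConst (D m : ℝ) : ℝ :=
  Real.pi ^ ((m - 1) / 2) / Real.Gamma ((m + 1) / 2) * (1 / (2 * Real.pi) ^ m) *
    (Real.Gamma (2 - D / 2) / (2 * (4 * Real.pi) ^ (D / 2)))

lemma feynman_section {D m p q : ℝ} (hD : 0 < D) (hD4 : D < 4) (v : ℝ) {t : ℝ} (ht : 0 < t) :
    deriv (fun t => 1 / (2 * Real.pi) ^ m * innerIntegral D p (v ^ 2 + t) ((v + q) ^ 2 + t)) t =
      -(1 / (2 * Real.pi) ^ m * (Real.Gamma (2 - D / 2) / (2 * (4 * Real.pi) ^ (D / 2))) *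
        ∫ y in (-1 : ℝ)..1, ((1 + y) * ((v + q) ^ 2 + t) + (1 - y) * (v ^ 2 + t)) * (2 - D / 2) *
          feynDen p ((v ^ 2 + t) ^ 2) (((v + q) ^ 2 + t) ^ 2) y ^ (-(2 - D / 2) - 1)) := by
  rw [((hasDerivAt_innerIntegral p q hD hD4 (v := v) (t := t) (by positivity)
    (by positivity)).const_mul _).deriv]
  ring

lemma feynman_eq_integral {D m p q : ℝ} (hD : 0 < D) (hm : 0 < m) (hD4 : D < 4)
    (ha : 0 < parA D m) (ha2 : parA D m < 2) (hp : 0 < p) (hq : 0 < q) :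
    feynman D m p q = feynConst D m * ∫ ω, momentKernel D m q 0 ω *
      (1 + parX p q * tauVar q ω) ^ (-(2 - D / 2 + 1)) ∂paramMeasure := by
  have hint := integrable_momentKernel_mul hm hD4 ha ha2 hp hq
  rw [integral_prod _ hint, integral_prod _ hint.integral_prod_left]
  unfold feynman dimIntegral
  -- The shift by q/2 makes the two masses symmetric under v ↦ -v.
  rw [← integral_sub_right_eq_self _ (q / 2), ← integral_const_mul]
  refine integral_congr_ae (Eventually.of_forall fun v => ?_)
  beta_reduce
  rw [← integral_const_mul, ← integral_const_mul]
  refine setIntegral_congr_fun measurableSet_Ioi fun t ht => ?_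
  have ht' : 0 < t := ht
  rw [feynman_section hD hD4 (v - q / 2) ht', ← intervalIntegral.integral_of_le (by norm_num),
    ← intervalIntegral.integral_congr (fun y hy => feynDen_kernel (D := D) (m := m) (v := v) hp hq ht'
      (by rwa [uIcc_of_le (by norm_num)] at hy)), intervalIntegral.integral_const_mul, feynConst]
  ring

/-- Multiplication by τ^r raises the power of 1 - y² by r and lowers that of `massDen` by r, giving
the r-th moment kernel up to the factor c/(c+r), which turns (c)_r into (c+1)_r. -/
lemma integral_tauVar_pow {D m q : ℝ} (hm : 0 < m) (hD4 : D < 4)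
    (ha : 0 < parA D m) (ha2 : parA D m < 2) (hq : 0 < q) (r : ℕ) :
    Integrable (fun ω => momentKernel D m q 0 ω * tauVar q ω ^ r) paramMeasure ∧
    poch (2 - D / 2 + 1) r / r.factorial * ∫ ω, momentKernel D m q 0 ω * tauVar q ω ^ r ∂paramMeasure =
      momentNorm D m q * (coeffC D m r * coeffF D m r) := by
  obtain ⟨hi, hv⟩ := integral_momentKernel hm hD4 ha ha2 hq r
  set c := 2 - D / 2 with hc
  have hc0 : 0 < c := by linarith
  have hcr : 0 < c + r := by positivity
  have he : (fun ω => momentKernel D m q 0 ω * tauVar q ω ^ r) =ᵐ[paramMeasure]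
      fun ω => c / (c + r) * (q ^ 4 / 16) ^ r * momentKernel D m q r ω := by
    filter_upwards [ae_paramMeasure] with ω hω
    have hM := massDen_pos (q := q) hω.1 hω.2
    simp only [momentKernel, tauVar, ← hc, ← massDen.eq_1, pow_zero, one_mul, Nat.cast_zero, add_zero]
    rw [show -(c + r) - 1 = (-c - 1) - (r : ℝ) by ring, Real.rpow_sub hM (-c - 1), Real.rpow_natCast,
      div_pow, mul_pow, mul_pow, div_pow]
    have := Real.rpow_pos_of_pos hM (-c - 1)
    field_simp
  refine ⟨(hi.const_mul _).congr he.symm, ?_⟩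
  rw [integral_congr_ae he, integral_const_mul, ← hv]
  have h1 := poch_eq_div (b := c) r
  have : poch (c + 1) r = poch c r * (c + r) / c := by rw [h1]; field_simp
  rw [this]
  field_simp

/-! ### Resummation of the series -/

lemma sum_antidiagonal_assoc (k : ℕ) (g : ℕ → ℕ → ℕ → ℝ) :
    ∑ x ∈ antidiagonal k, ∑ y ∈ antidiagonal x.2, g x.1 y.1 y.2 =
      ∑ x ∈ antidiagonal k, ∑ y ∈ antidiagonal x.1, g y.1 y.2 x.2 := by
  rw [Finset.sum_sigma', Finset.sum_sigma']
  refine Finset.sum_nbij' (fun x => ⟨(x.1.1 + x.2.1, x.2.2), (x.1.1, x.2.1)⟩)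
    (fun x => ⟨(x.2.1, x.2.2 + x.1.2), (x.2.2, x.1.2)⟩) ?_ ?_ ?_ ?_ ?_
  · rintro ⟨⟨i, j⟩, ⟨l, r⟩⟩ h
    simp only [Finset.mem_sigma, Finset.HasAntidiagonal.mem_antidiagonal] at h ⊢
    exact ⟨by omega, trivial⟩
  · rintro ⟨⟨i, j⟩, ⟨l, r⟩⟩ h
    simp only [Finset.mem_sigma, Finset.HasAntidiagonal.mem_antidiagonal] at h ⊢
    exact ⟨by omega, trivial⟩
  · rintro ⟨⟨i, j⟩, ⟨l, r⟩⟩ h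
    simp only [Finset.mem_sigma, Finset.HasAntidiagonal.mem_antidiagonal] at h
    obtain ⟨_, rfl⟩ := h
    rfl
  · rintro ⟨⟨i, j⟩, ⟨l, r⟩⟩ h
    simp only [Finset.mem_sigma, Finset.HasAntidiagonal.mem_antidiagonal] at h
    obtain ⟨_, rfl⟩ := h
    rfl
  · rintro ⟨⟨i, j⟩, ⟨l, r⟩⟩ h
    rfl

/-- Coefficient of `ζ ^ k` in `(1 - ζ) ^ (c - e) * (1 - ζ * (1 - τ)) ^ (-c)`. -/
noncomputable def resumCoeff (e c : ℝ) (k : ℕ) (τ : ℝ) : ℝ :=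
  ∑ ij ∈ antidiagonal k, poch (e - c) ij.1 / (ij.1.factorial : ℝ) *
    (poch c ij.2 / (ij.2.factorial : ℝ) * (1 - τ) ^ ij.2)

/-- Expanding (1 - τ)^j and collecting τ^r leaves a Chu–Vandermonde sum with parameters e - c and c
+ r. Their sum e + r is free of c, so the moments' own factor (c)_r / r! is all that remains of c.
-/
lemma resumCoeff_eq (e c : ℝ) (k : ℕ) (τ : ℝ) :
    resumCoeff e c k τ = ∑ r ∈ Finset.range (k + 1),
      poch (e + r) (k - r) / ((k - r).factorial : ℝ) * (poch c r / r.factorial * (-τ) ^ r) := by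
  have h1 : ∀ j : ℕ, poch c j / (j.factorial : ℝ) * (1 - τ) ^ j =
      ∑ lr ∈ antidiagonal j, poch (c + lr.2) lr.1 / (lr.1.factorial : ℝ) *
        (poch c lr.2 / (lr.2.factorial : ℝ) * (-τ) ^ lr.2) := fun j => by
    rw [show 1 - τ = 1 + -τ by ring, add_pow, ← Finset.Nat.sum_antidiagonal_eq_sum_range_succ_mk
      (f := fun lr => 1 ^ lr.1 * (-τ) ^ lr.2 * (j.choose lr.1 : ℝ)), Finset.mul_sum]
    refine Finset.sum_congr rfl fun lr hlr => ?_
    obtain ⟨l, r⟩ := lr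
    have hj : l + r = j := mem_antidiagonal.1 hlr
    subst hj
    have hc := Nat.add_choose_mul_factorial_mul_factorial l r
    rw [← Nat.choose_symm_add] at hc
    have hc' : ((l + r).choose l : ℝ) * l.factorial * r.factorial = (l + r).factorial := by
      exact_mod_cast hc
    have f1 : (l.factorial : ℝ) ≠ 0 := by positivity
    have f2 : (r.factorial : ℝ) ≠ 0 := by positivity
    have f3 : ((l + r).choose l : ℝ) ≠ 0 := by exact_mod_cast (Nat.choose_pos (by omega)).ne'
    simp only [← hc', one_pow, one_mul]
    rw [show poch c (l + r) = poch c r * poch (c + r) l by rw [add_comm l r, poch_add]]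
    field_simp
  unfold resumCoeff
  simp_rw [h1, Finset.mul_sum]
  rw [sum_antidiagonal_assoc k (fun i l r => poch (e - c) i / (i.factorial : ℝ) *
    (poch (c + r) l / (l.factorial : ℝ) * (poch c r / (r.factorial : ℝ) * (-τ) ^ r)))]
  rw [← Finset.Nat.sum_antidiagonal_swap, Finset.Nat.sum_antidiagonal_eq_sum_range_succ_mk]
  refine Finset.sum_congr rfl fun r _ => ?_
  simp only [Prod.swap]
  have h2 := sum_poch_div (e - c) (c + r) (k - r)
  rw [show e - c + (c + r) = e + r by ring] at h2
  rw [← h2, Finset.sum_mul]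
  refine Finset.sum_congr rfl fun ij _ => ?_
  ring

/-- A bound for `resumCoeff` which is uniform on `[0, 1]`. -/
noncomputable def resumBound (e c : ℝ) (k : ℕ) : ℝ :=
  ∑ ij ∈ antidiagonal k, |poch (e - c) ij.1 / (ij.1.factorial : ℝ)| *
    (poch c ij.2 / (ij.2.factorial : ℝ))

lemma abs_resumCoeff_le {e c τ : ℝ} (hc : 0 < c) (hτ : τ ∈ Icc (0 : ℝ) 1) (k : ℕ) :
    |resumCoeff e c k τ| ≤ resumBound e c k := by
  refine (Finset.abs_sum_le_sum_abs _ _).trans (Finset.sum_le_sum fun ij _ => ?_)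
  have hp := poch_pos hc ij.2
  rw [abs_mul, abs_mul, abs_of_nonneg (by positivity : 0 ≤ poch c ij.2 / (ij.2.factorial : ℝ)),
    abs_of_nonneg (pow_nonneg (by linarith [hτ.2] : 0 ≤ 1 - τ) _)]
  gcongr
  exact mul_le_of_le_one_right (by positivity) (pow_le_one₀ (by linarith [hτ.2]) (by linarith [hτ.1]))

lemma sum_antidiagonal_mul_pow (f g : ℕ → ℝ) (ζ : ℝ) (k : ℕ) :
    ∑ ij ∈ antidiagonal k, (f ij.1 * ζ ^ ij.1) * (g ij.2 * ζ ^ ij.2) =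
      (∑ ij ∈ antidiagonal k, f ij.1 * g ij.2) * ζ ^ k := by
  rw [Finset.sum_mul]
  refine Finset.sum_congr rfl fun ij hij => ?_
  rw [← mem_antidiagonal.1 hij, pow_add]; ring

/-- The bound is the Cauchy product of two absolutely convergent binomial series; absolute values
are kept on the first because e - c may be negative. -/
lemma summable_resumBound {e c ζ : ℝ} (hc : 0 < c) (hζ0 : 0 ≤ ζ) (hζ : ζ < 1) :
    Summable fun k => resumBound e c k * ζ ^ k := by
  have hζ' : |ζ| < 1 := by rwa [abs_of_nonneg hζ0]
  have h1 := (hasSum_poch_binomial (e - c) hζ').summable.abs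
  have h2 := (hasSum_poch_binomial c hζ').summable.abs
  have h3 := summable_norm_sum_mul_antidiagonal_of_summable_norm
    (f := fun n => |poch (e - c) n / n.factorial * ζ ^ n|)
    (g := fun n => |poch c n / n.factorial * ζ ^ n|) (by simpa using h1) (by simpa using h2)
  refine h3.of_norm.congr fun k => ?_
  have h4 := sum_antidiagonal_mul_pow (fun n => |poch (e - c) n / n.factorial|)
    (fun n => poch c n / n.factorial) ζ k
  rw [resumBound, ← h4]
  refine Finset.sum_congr rfl fun ij _ => ?_
  have hp := poch_pos hc ij.2
  simp only [abs_mul]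
  rw [abs_of_nonneg (pow_nonneg hζ0 ij.1), abs_of_nonneg (pow_nonneg hζ0 ij.2),
    abs_of_nonneg (by positivity : 0 ≤ poch c ij.2 / (ij.2.factorial : ℝ))]

lemma hasSum_resumCoeff {e c ζ τ : ℝ} (hc : 0 < c) (hζ0 : 0 ≤ ζ) (hζ : ζ < 1)
    (hτ : τ ∈ Icc (0 : ℝ) 1) :
    HasSum (fun k => resumCoeff e c k τ * ζ ^ k)
      ((1 - ζ) ^ (c - e) * (1 - ζ * (1 - τ)) ^ (-c)) := by
  have hζ' : |ζ| < 1 := by rwa [abs_of_nonneg hζ0]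
  have h1τ : 0 ≤ 1 - τ := by linarith [hτ.2]
  have hζτ : |ζ * (1 - τ)| < 1 := by
    rw [abs_of_nonneg (by positivity)]
    exact lt_of_le_of_lt (mul_le_of_le_one_right hζ0 (by linarith [hτ.1])) hζ
  have h1 := hasSum_poch_binomial (e - c) hζ'
  have h2 := hasSum_poch_binomial c hζτ
  have h3 := tsum_mul_tsum_eq_tsum_sum_antidiagonal_of_summable_norm h1.summable.norm
    h2.summable.norm
  have h4 : Summable fun k => resumCoeff e c k τ * ζ ^ k := by
    refine Summable.of_norm_bounded (summable_resumBound (e := e) hc hζ0 hζ) fun k => ?_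
    rw [norm_mul, Real.norm_of_nonneg (pow_nonneg hζ0 k)]
    exact mul_le_mul_of_nonneg_right (abs_resumCoeff_le hc hτ k) (pow_nonneg hζ0 k)
  rw [h1.tsum_eq, h2.tsum_eq, neg_sub] at h3
  rw [h3]
  refine hasSum_of_eq h4.hasSum (fun k => rfl) (tsum_congr fun k => ?_)
  rw [resumCoeff, ← sum_antidiagonal_mul_pow (fun n => poch (e - c) n / (n.factorial : ℝ))
    (fun n => poch c n / (n.factorial : ℝ) * (1 - τ) ^ n)]
  refine Finset.sum_congr rfl fun ij _ => ?_
  rw [mul_pow]; ring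

/-- Termwise integration of the resummed series. -/
lemma hasSum_resummed_integral {Ω : Type*} [MeasurableSpace Ω] {μ : Measure Ω} {W τ : Ω → ℝ}
    {e c X : ℝ} (hc : 0 < c) (hX : 0 ≤ X)
    (hτ : ∀ᵐ ω ∂μ, τ ω ∈ Icc (0 : ℝ) 1) (hτm : Measurable τ)
    (hW : ∀ r : ℕ, Integrable (fun ω => W ω * τ ω ^ r) μ) :
    HasSum (fun k => (∑ r ∈ Finset.range (k + 1), poch (e + r) (k - r) / ((k - r).factorial : ℝ) *
        ((-1) ^ r * (poch c r / r.factorial * ∫ ω, W ω * τ ω ^ r ∂μ))) * (X / (1 + X)) ^ k)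
      ((1 + X) ^ e * ∫ ω, W ω * (1 + X * τ ω) ^ (-c) ∂μ) := by
  have hW0 : Integrable W μ := by simpa using hW 0
  set ζ := X / (1 + X) with hζdef
  have hζ0 : 0 ≤ ζ := by positivity
  have hζ1 : ζ < 1 := by rw [hζdef, div_lt_one (by positivity)]; linarith
  have h1ζ : 1 - ζ = (1 + X)⁻¹ := by rw [hζdef]; field_simp; ring
  let F : ℕ → Ω → ℝ := fun k ω => W ω * (resumCoeff e c k (τ ω) * ζ ^ k)
  have hFeq : ∀ k ω, F k ω = ∑ r ∈ Finset.range (k + 1),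
      (poch (e + r) (k - r) / ((k - r).factorial : ℝ) * ((-1) ^ r * (poch c r / r.factorial)) *
        ζ ^ k) * (W ω * τ ω ^ r) := fun k ω => by
    simp only [F]
    rw [resumCoeff_eq, Finset.sum_mul, Finset.mul_sum]
    refine Finset.sum_congr rfl fun r _ => ?_
    rw [neg_pow]; ring
  have hF : ∀ k, Integrable (F k) μ := fun k => by
    rw [funext (hFeq k)]
    exact integrable_finsetSum _ fun r _ => (hW r).const_mul _
  have hs : Summable fun k => ∫ ω, ‖F k ω‖ ∂μ := by
    refine Summable.of_nonneg_of_le (fun _ => integral_nonneg fun _ => norm_nonneg _) (fun k => ?_)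
      ((summable_resumBound (e := e) hc hζ0 hζ1).mul_right (∫ ω, ‖W ω‖ ∂μ))
    rw [← integral_const_mul]
    refine integral_mono_ae (hF k).norm (hW0.norm.const_mul _) ?_
    filter_upwards [hτ] with ω hω
    simp only [F]
    rw [norm_mul, mul_comm ‖W ω‖, norm_mul, Real.norm_of_nonneg (pow_nonneg hζ0 k)]
    have := abs_resumCoeff_le (e := e) hc hω k
    rw [← Real.norm_eq_abs] at this
    gcongr
  have hH : ∀ᵐ ω ∂μ, HasSum (fun k => F k ω) ((1 + X) ^ e * (W ω * (1 + X * τ ω) ^ (-c))) := by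
    filter_upwards [hτ] with ω hω
    refine hasSum_of_eq ((hasSum_resumCoeff (e := e) hc hζ0 hζ1 hω).mul_left (W ω))
      (fun k => rfl) ?_
    -- This factorisation makes the expansion valid for every X ≥ 0.
    have h2 : 1 - ζ * (1 - τ ω) = (1 + X)⁻¹ * (1 + X * τ ω) := by
      rw [hζdef]; field_simp; ring
    have hXτ : 0 < 1 + X * τ ω := by linarith [mul_nonneg hX hω.1]
    rw [h2, h1ζ, Real.mul_rpow (by positivity) hXτ.le, Real.inv_rpow (by positivity),
      Real.inv_rpow (by positivity), Real.rpow_sub (by positivity), Real.rpow_neg (by positivity) c,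
      inv_inv]
    have a1 : 0 < (1 + X) ^ c := by positivity
    have a2 : 0 < (1 + X) ^ e := by positivity
    field_simp
  have hmeas : AEStronglyMeasurable (fun ω => (1 + X) ^ e * (W ω * (1 + X * τ ω) ^ (-c))) μ :=
    (hW0.1.mul (Measurable.aestronglyMeasurable (by fun_prop))).const_mul _
  have h := (integrable_and_hasSum_integral hF hs hmeas hH).2
  refine hasSum_of_eq h (fun k => ?_) (integral_const_mul _ _)
  rw [funext (hFeq k), integral_finsetSum _ fun r _ => (hW r).const_mul _, Finset.sum_mul]
  refine Finset.sum_congr rfl fun r _ => ?_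
  rw [integral_const_mul]; ring

lemma poch_mul_upsilon {D m : ℝ} (ha : 0 < parA D m) (k : ℕ) :
    poch (parA D m / 2) k / k.factorial * upsilon D m k =
      ∑ r ∈ Finset.range (k + 1), poch (parA D m / 2 + r) (k - r) / ((k - r).factorial : ℝ) *
        ((-1) ^ r * (coeffC D m r * coeffF D m r)) := by
  rw [upsilon, Finset.mul_sum]
  refine Finset.sum_congr rfl fun r hr => ?_
  have hrk : r ≤ k := by have := Finset.mem_range.1 hr; omega
  have h1 : poch (parA D m / 2) k = poch (parA D m / 2) r * poch (parA D m / 2 + r) (k - r) := by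
    rw [← poch_add, Nat.add_sub_cancel' hrk]
  have h2 := poch_ne_zero (x := parA D m / 2) (by positivity) r
  rw [h1, poch_neg_nat hrk]
  field_simp

/-! ### Normalisation and the expansion -/

lemma feynConst_mul_momentNorm {D m q : ℝ} (hm : 0 < m) (hD4 : D < 4) (hq : 0 < q) :
    feynConst D m * momentNorm D m q = coeffA D m * q ^ (-4 + 2 * eps D m) := by
  have e2 : (2 : ℝ) = Real.exp (Real.log 2) := (Real.exp_log two_pos).symm
  have eπ : Real.pi = Real.exp (Real.log Real.pi) := (Real.exp_log Real.pi_pos).symm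
  have hs : Real.pi ^ ((m - 1) / 2) * √Real.pi * √Real.pi * 4 ^ parA D m *
      2 ^ (1 - 2 * (2 - D / 2)) * (16 * Real.pi) ^ ((D + m - 1) / 2) =
      8 * (2 * Real.pi) ^ m * (4 * Real.pi) ^ (D / 2) := by
    rw [Real.sqrt_eq_rpow, show (4 : ℝ) = 2 ^ (2 : ℕ) by norm_num,
      show (16 : ℝ) = 2 ^ (4 : ℕ) by norm_num, show (8 : ℝ) = 2 ^ (3 : ℕ) by norm_num, parA]
    -- Every factor becomes an exponential, leaving an identity between exponents that is linear in
    -- log 2 and log π. The rewriting also hits the numerals 2 inside exponents, which `← e2`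
    -- restores.
    generalize Real.log 2 = L2 at e2
    generalize Real.log Real.pi = Lπ at eπ
    rw [eπ, e2]
    simp only [← Real.exp_nat_mul, ← Real.exp_add, ← Real.exp_mul]
    congr 1
    rw [← e2]
    push_cast
    ring
  have hdup := Real.Gamma_mul_Gamma_add_half (2 - D / 2)
  rw [show 2 - D / 2 + 1 / 2 = (5 - D) / 2 by ring] at hdup
  have hq2 : (q ^ 2 / 4) ^ (-parA D m) = 4 ^ parA D m * q ^ (-4 + 2 * eps D m) := by
    rw [Real.div_rpow (by positivity) (by norm_num), Real.rpow_neg (by norm_num : (0 : ℝ) ≤ 4),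
      ← Real.rpow_natCast q 2, ← Real.rpow_mul hq.le,
      show ((2 : ℕ) : ℝ) * -parA D m = -4 + 2 * eps D m by rw [parA, eps]; push_cast; ring]
    field_simp
  have h1 := Real.Gamma_pos_of_pos (show 0 < (m + 1) / 2 by linarith)
  have h3 := Real.Gamma_pos_of_pos (show 0 < 2 * (2 - D / 2) by linarith)
  have h4 := Real.Gamma_pos_of_pos (show 0 < (5 - D) / 2 by linarith)
  have hπ := Real.pi_pos
  have k1 : 0 < (2 * Real.pi) ^ m := by positivity
  have k2 : 0 < (4 * Real.pi) ^ (D / 2) := by positivity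
  have k3 : 0 < (16 * Real.pi) ^ ((D + m - 1) / 2) := by positivity
  rw [feynConst, momentNorm, coeffA, hq2, show 2 - eps D m = parA D m by rw [eps, parA]; ring]
  generalize Real.Gamma ((m + 1) / 2) = G1 at *
  generalize Real.Gamma (2 * (2 - D / 2)) = G3 at *
  generalize Real.Gamma ((5 - D) / 2) = G4 at *
  generalize Real.Gamma (2 - D / 2) = G5 at *
  generalize Real.Gamma (parA D m) = G6 at *
  generalize (2 * Real.pi) ^ m = x1 at *
  generalize (4 * Real.pi) ^ (D / 2) = x2 at *
  generalize (16 * Real.pi) ^ ((D + m - 1) / 2) = x3 at *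
  generalize q ^ (-4 + 2 * eps D m) = Q at *
  generalize Real.pi ^ ((m - 1) / 2) = x4 at *
  generalize (2 : ℝ) ^ (1 - 2 * (2 - D / 2)) = x5 at *
  generalize (4 : ℝ) ^ parA D m = x6 at *
  generalize √Real.pi = x7 at *
  field_simp
  linear_combination (x4 * x6 * x7 * x3 * Q * G6) * hdup + Q * G6 * G3 * hs

/-- The expansion of the Feynman integral. -/
lemma feynman_hasSum {D m p q : ℝ} (hD : 0 < D) (hm : 0 < m) (hD4 : D < 4)
    (ha : 0 < parA D m) (ha2 : parA D m < 2) (hp : 0 < p) (hq : 0 < q) :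
    Summable (fun k : ℕ => poch (parA D m / 2) k / (k.factorial : ℝ) *
      upsilon D m k * zeta p q ^ k) ∧
    feynman D m p q = coeffA D m * q ^ (-4 + 2 * eps D m) / (1 + parX p q) ^ (parA D m / 2) *
        ∑' k : ℕ, poch (parA D m / 2) k / (k.factorial : ℝ) * upsilon D m k * zeta p q ^ k := by
  have hX := parX_pos hp hq
  have hτ := fun r => integral_tauVar_pow hm hD4 ha ha2 hq r
  have h := hasSum_resummed_integral (μ := paramMeasure) (W := momentKernel D m q 0)
    (τ := tauVar q) (e := parA D m / 2) (c := 2 - D / 2 + 1) (by linarith) hX.le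
    (ae_paramMeasure.mono fun ω hω => tauVar_mem hω.1 hω.2) (measurable_tauVar q)
    (fun r => (hτ r).1)
  have hN : 0 < momentNorm D m q := by
    have h1 := Real.Gamma_pos_of_pos (show 0 < (m + 1) / 2 by linarith)
    have h2 := Real.Gamma_pos_of_pos ha
    have h3 := Real.Gamma_pos_of_pos (show 0 < 2 * (2 - D / 2) by linarith)
    have h4 := Real.pi_pos
    unfold momentNorm
    positivity
  have h1 : HasSum (fun k : ℕ => poch (parA D m / 2) k / (k.factorial : ℝ) *
      upsilon D m k * zeta p q ^ k) ((momentNorm D m q)⁻¹ * ((1 + parX p q) ^ (parA D m / 2) *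
        ∫ ω, momentKernel D m q 0 ω * (1 + parX p q * tauVar q ω) ^ (-(2 - D / 2 + 1))
          ∂paramMeasure)) := by
    refine hasSum_of_eq (h.mul_left (momentNorm D m q)⁻¹) (fun k => ?_) rfl
    simp only [(hτ _).2]
    rw [poch_mul_upsilon ha, ← mul_assoc, Finset.mul_sum, zeta]
    congr 1
    refine Finset.sum_congr rfl fun r _ => ?_
    field_simp
  refine ⟨h1.summable, ?_⟩
  rw [h1.tsum_eq, feynman_eq_integral hD hm hD4 ha ha2 hp hq, ← feynConst_mul_momentNorm hm hD4 hq]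
  have : 0 < (1 + parX p q) ^ (parA D m / 2) := by positivity
  field_simp

/-! ### Integer dimensions: comparison with the Lebesgue integral -/

lemma volume_euclidean_norm_sq_lt (n : ℕ) {s : ℝ} (hs : 0 < s) :
    volume {y : EuclideanSpace ℝ (Fin n) | ‖y‖ ^ 2 < s} =
      ENNReal.ofReal (Real.pi ^ ((n : ℝ) / 2) / Real.Gamma ((n : ℝ) / 2 + 1) * s ^ ((n : ℝ) / 2)) := by
  have hset : {y : EuclideanSpace ℝ (Fin n) | ‖y‖ ^ 2 < s} = Metric.ball 0 √s := by
    ext y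
    simp [Real.lt_sqrt (norm_nonneg y)]
  rw [hset]
  -- Dimension 0 is the transverse space of a line (D = 1 or m = 1): a single point of mass 1.
  rcases Nat.eq_zero_or_pos n with rfl | hn
  · have : Metric.ball (0 : EuclideanSpace ℝ (Fin 0)) √s = univ := by
      ext y
      simp [Subsingleton.elim y 0, hs]
    rw [this]
    have h1 : volume (univ : Set (EuclideanSpace ℝ (Fin 0))) = 1 := by
      rw [← (PiLp.volume_preserving_toLp (Fin 0)).measure_preimage nullMeasurableSet_univ]
      simp [volume_pi]
    rw [h1]
    simp
  · have : Nonempty (Fin n) := ⟨⟨0, hn⟩⟩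
    rw [EuclideanSpace.volume_ball, Fintype.card_fin, ← ENNReal.ofReal_pow (by positivity),
      ← ENNReal.ofReal_mul (by positivity), Real.sqrt_eq_rpow, Real.sqrt_eq_rpow,
      ← Real.rpow_natCast, ← Real.rpow_natCast, ← Real.rpow_mul hs.le,
      ← Real.rpow_mul Real.pi_pos.le, mul_comm, one_div_mul_eq_div]

/-- Layer-cake formula over Euclidean space for a function of the squared norm. -/
lemma lintegral_euclidean_tail (n : ℕ) {H : ℝ → ENNReal} (hH : Measurable H) :
    ∫⁻ y : EuclideanSpace ℝ (Fin n), ∫⁻ s in Ioi (‖y‖ ^ 2), H s =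
      ∫⁻ s in Ioi 0, ENNReal.ofReal (Real.pi ^ ((n : ℝ) / 2) / Real.Gamma ((n : ℝ) / 2 + 1) *
        s ^ ((n : ℝ) / 2)) * H s := by
  have h1 : ∀ y : EuclideanSpace ℝ (Fin n), ∫⁻ s in Ioi (‖y‖ ^ 2), H s =
      ∫⁻ s in Ioi 0, {z : EuclideanSpace ℝ (Fin n) × ℝ | ‖z.1‖ ^ 2 < z.2}.indicator
        (fun z => H z.2) (y, s) := by
    intro y
    rw [← lintegral_indicator measurableSet_Ioi, ← lintegral_indicator measurableSet_Ioi]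
    refine lintegral_congr fun s => ?_
    by_cases hs : ‖y‖ ^ 2 < s
    · have : 0 < s := (sq_nonneg _).trans_lt hs
      simp [indicator, hs, this]
    · simp [indicator, hs]
  have hmeas : MeasurableSet {z : EuclideanSpace ℝ (Fin n) × ℝ | ‖z.1‖ ^ 2 < z.2} :=
    measurableSet_lt (by fun_prop) (by fun_prop)
  simp_rw [h1]
  rw [lintegral_lintegral_swap (f := fun y s =>
      {z : EuclideanSpace ℝ (Fin n) × ℝ | ‖z.1‖ ^ 2 < z.2}.indicator (fun z => H z.2) (y, s))
    ((hH.comp measurable_snd).indicator hmeas).aemeasurable]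
  refine setLIntegral_congr_fun measurableSet_Ioi fun s hs => ?_
  rw [← volume_euclidean_norm_sq_lt n hs, mul_comm, ← lintegral_indicator_const]
  · rfl
  · exact measurableSet_lt (by fun_prop) (by fun_prop)

/-- Splitting off the coordinate along the axis spanned by `P`. -/
lemma lintegral_axis {n : ℕ} {P : EuclideanSpace ℝ (Fin (n + 1))} (hP : P ≠ 0)
    {g : ℝ → ℝ → ENNReal} (hg : Measurable (Function.uncurry g)) :
    ∫⁻ x : EuclideanSpace ℝ (Fin (n + 1)),
        g (inner ℝ P x / ‖P‖) (‖x‖ ^ 2 - (inner ℝ P x / ‖P‖) ^ 2) =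
      ∫⁻ u : ℝ, ∫⁻ y : EuclideanSpace ℝ (Fin n), g u (‖y‖ ^ 2) := by
  have hP' : ‖P‖ ≠ 0 := norm_ne_zero_iff.2 hP
  obtain ⟨b, hb⟩ := Orthonormal.exists_orthonormalBasis_extension_of_card_eq (𝕜 := ℝ)
    (E := EuclideanSpace ℝ (Fin (n + 1))) (ι := Fin (n + 1)) (by simp)
    (v := fun _ => ‖P‖⁻¹ • P) (s := {0}) (by
      refine ⟨fun i => ?_, fun i j hij => (hij (Subsingleton.elim i j)).elim⟩
      simp [domRestrict, norm_smul, hP'])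
  have hb0 : b 0 = ‖P‖⁻¹ • P := hb 0 rfl
  have hrepr : ∀ x, b.repr x 0 = inner ℝ P x / ‖P‖ := fun x => by
    rw [b.repr_apply_apply, hb0, real_inner_smul_left, inv_mul_eq_div]
  have h1 : ∫⁻ x : EuclideanSpace ℝ (Fin (n + 1)),
        g (inner ℝ P x / ‖P‖) (‖x‖ ^ 2 - (inner ℝ P x / ‖P‖) ^ 2) =
      ∫⁻ z : EuclideanSpace ℝ (Fin (n + 1)), g (z 0) (‖z‖ ^ 2 - z 0 ^ 2) := by
    rw [← b.measurePreserving_repr.lintegral_comp (f := fun z => g (z 0) (‖z‖ ^ 2 - z 0 ^ 2))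
      (hg.comp (f := fun z : EuclideanSpace ℝ (Fin (n + 1)) => (z 0, ‖z‖ ^ 2 - z 0 ^ 2))
        (by fun_prop))]
    simp only [hrepr, LinearIsometryEquiv.norm_map]
  have h2 : ∫⁻ z : EuclideanSpace ℝ (Fin (n + 1)), g (z 0) (‖z‖ ^ 2 - z 0 ^ 2) =
      ∫⁻ w : Fin (n + 1) → ℝ, g (w 0) (∑ i : Fin n, w i.succ ^ 2) := by
    rw [← (PiLp.volume_preserving_toLp (Fin (n + 1))).lintegral_comp
      (f := fun z => g (z 0) (‖z‖ ^ 2 - z 0 ^ 2))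
      (hg.comp (f := fun z : EuclideanSpace ℝ (Fin (n + 1)) => (z 0, ‖z‖ ^ 2 - z 0 ^ 2))
        (by fun_prop))]
    refine lintegral_congr fun w => ?_
    rw [EuclideanSpace.real_norm_sq_eq, Fin.sum_univ_succ, add_sub_cancel_left]
  have hm3 : Measurable fun z : ℝ × (Fin n → ℝ) => g z.1 (∑ i, z.2 i ^ 2) :=
    hg.comp (f := fun z : ℝ × (Fin n → ℝ) => (z.1, ∑ i, z.2 i ^ 2)) (by fun_prop)
  have h3 : ∫⁻ w : Fin (n + 1) → ℝ, g (w 0) (∑ i : Fin n, w i.succ ^ 2) =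
      ∫⁻ z : ℝ × (Fin n → ℝ), g z.1 (∑ i, z.2 i ^ 2) := by
    rw [← (volume_preserving_piFinSuccAbove (fun _ : Fin (n + 1) => ℝ) 0).lintegral_comp hm3]
    rfl
  rw [h1, h2, h3, Measure.volume_eq_prod, lintegral_prod _ hm3.aemeasurable]
  refine lintegral_congr fun u => ?_
  rw [← (PiLp.volume_preserving_toLp (Fin n)).lintegral_comp (f := fun y => g u (‖y‖ ^ 2))
      (hg.comp (f := fun y : EuclideanSpace ℝ (Fin n) => (u, ‖y‖ ^ 2)) (by fun_prop))]
  refine lintegral_congr fun w => ?_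
  rw [EuclideanSpace.real_norm_sq_eq]

/-- The conditions under which a function of the squared transverse distance is recovered from its
derivative. -/
structure DecreasesToZero (g : ℝ → ℝ) : Prop where
  continuousWithinAt : ContinuousWithinAt g (Ici 0) 0
  differentiableAt : ∀ s, 0 < s → DifferentiableAt ℝ g s
  deriv_nonpos : ∀ s, 0 < s → deriv g s ≤ 0
  tendsto : Tendsto g atTop (𝓝 0)

/-- The fundamental theorem of calculus on [s, ∞); the sign of the derivative makes it integrable.
At s = 0 one-sided continuity is enough. -/
lemma DecreasesToZero.ofReal_eq {g : ℝ → ℝ} (hg : DecreasesToZero g) {s : ℝ} (hs : 0 ≤ s) :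
    ENNReal.ofReal (g s) = ∫⁻ r in Ioi s, ENNReal.ofReal (-deriv g r) := by
  have hc : ContinuousWithinAt g (Ici s) s := by
    rcases hs.eq_or_lt with rfl | h
    · exact hg.continuousWithinAt
    · exact (hg.differentiableAt s h).continuousAt.continuousWithinAt
  have hd : ∀ x ∈ Ioi s, HasDerivAt g (deriv g x) x := fun x hx =>
    (hg.differentiableAt x (hs.trans_lt hx)).hasDerivAt
  have hn : ∀ x ∈ Ioi s, deriv g x ≤ 0 := fun x hx => hg.deriv_nonpos x (hs.trans_lt hx)
  rw [← ofReal_integral_eq_lintegral_ofReal (f := fun r => -deriv g r)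
    (integrableOn_Ioi_deriv_of_nonpos hc hd hn hg.tendsto).neg, integral_neg,
    integral_Ioi_of_hasDerivAt_of_nonpos hc hd hn hg.tendsto, zero_sub, neg_neg]
  filter_upwards [ae_restrict_mem measurableSet_Ioi] with x hx
  simpa using hn x hx

/-- In integer dimension `dimIntegral` is the ordinary integral. -/
lemma lintegral_eq_dimIntegral {n : ℕ} {P : EuclideanSpace ℝ (Fin (n + 1))} (hP : P ≠ 0)
    {f : ℝ → ℝ → ℝ} (hf : Measurable (Function.uncurry f))
    (hdec : ∀ᵐ u, DecreasesToZero (f u))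
    (hint : Integrable (fun z : ℝ × ℝ => z.2 ^ ((((n + 1 : ℕ) : ℝ) - 1) / 2) * deriv (f z.1) z.2)
      (volume.prod (volume.restrict (Ioi 0)))) :
    0 ≤ dimIntegral ((n + 1 : ℕ) : ℝ) f ∧
    ∫⁻ x : EuclideanSpace ℝ (Fin (n + 1)), ENNReal.ofReal
        (f (inner ℝ P x / ‖P‖) (‖x‖ ^ 2 - (inner ℝ P x / ‖P‖) ^ 2)) =
      ENNReal.ofReal (dimIntegral ((n + 1 : ℕ) : ℝ) f) := by
  set K : ℝ := Real.pi ^ ((((n + 1 : ℕ) : ℝ) - 1) / 2) / Real.Gamma ((((n + 1 : ℕ) : ℝ) + 1) / 2)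
    with hK
  have hK0 : 0 < K := by
    have := Real.Gamma_pos_of_pos (show 0 < (((n + 1 : ℕ) : ℝ) + 1) / 2 by positivity)
    have := Real.pi_pos
    positivity
  have hdim : dimIntegral ((n + 1 : ℕ) : ℝ) f =
      ∫ z : ℝ × ℝ, -K * (z.2 ^ ((((n + 1 : ℕ) : ℝ) - 1) / 2) * deriv (f z.1) z.2)
        ∂(volume.prod (volume.restrict (Ioi 0))) := by
    rw [integral_const_mul, integral_prod _ hint, dimIntegral, integral_const_mul]
  have hnn : 0 ≤ᵐ[volume.prod (volume.restrict (Ioi 0))] fun z : ℝ × ℝ =>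
      -K * (z.2 ^ ((((n + 1 : ℕ) : ℝ) - 1) / 2) * deriv (f z.1) z.2) := by
    filter_upwards [ae_snd_pos, Measure.quasiMeasurePreserving_fst.ae hdec] with z hz hz'
    have := hz'.deriv_nonpos _ hz
    have := mul_nonneg (mul_nonneg hK0.le (Real.rpow_nonneg hz.le ((((n + 1 : ℕ) : ℝ) - 1) / 2)))
      (neg_nonneg.2 this)
    simp only [Pi.zero_apply]
    linarith
  refine ⟨hdim ▸ integral_nonneg_of_ae hnn, ?_⟩
  rw [hdim, ofReal_integral_eq_lintegral_ofReal (hint.const_mul _) hnn,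
    lintegral_prod _ (hint.const_mul _).aestronglyMeasurable.aemeasurable.ennreal_ofReal,
    lintegral_axis (g := fun u s => ENNReal.ofReal (f u s)) hP hf.ennreal_ofReal]
  refine lintegral_congr_ae ?_
  filter_upwards [hdec] with u hu
  -- The layer-cake formula introduces the volume of the transverse ball, which is exactly the
  -- weight in `dimIntegral`.
  simp_rw [hu.ofReal_eq (sq_nonneg _)]
  rw [lintegral_euclidean_tail n (H := fun r => ENNReal.ofReal (-deriv (f u) r))
    (measurable_deriv (f u)).neg.ennreal_ofReal]
  refine setLIntegral_congr_fun measurableSet_Ioi fun s hs => ?_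
  have hs' : 0 < s := hs
  rw [← ENNReal.ofReal_mul]
  · congr 1
    rw [hK]
    push_cast
    rw [add_sub_cancel_right, show ((n : ℝ) + 1 + 1) / 2 = (n : ℝ) / 2 + 1 by ring]
    ring
  · have := Real.Gamma_pos_of_pos (show 0 < (n : ℝ) / 2 + 1 by positivity)
    have := Real.pi_pos
    positivity

lemma norm_add_sq_of_axis {E : Type*} [NormedAddCommGroup E] [InnerProductSpace ℝ E] {P : E}
    (hP : P ≠ 0) (x : E) :
    (inner ℝ P x / ‖P‖ + ‖P‖) ^ 2 + (‖x‖ ^ 2 - (inner ℝ P x / ‖P‖) ^ 2) = ‖x + P‖ ^ 2 := by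
  have : ‖P‖ ≠ 0 := norm_ne_zero_iff.2 hP
  rw [norm_add_sq_real, real_inner_comm]
  field_simp
  ring

lemma decreasesToZero_propagators {k A B : ℝ} (hk : 0 ≤ k) (hA : 0 < A) (hB : 0 < B) :
    DecreasesToZero fun s => k * (1 / (A + s)) * (1 / (B + s)) := by
  have hd : ∀ s, 0 ≤ s → HasDerivAt (fun s => k * (1 / (A + s)) * (1 / (B + s)))
      (-(k * ∫ y in (-1 : ℝ)..1, (((1 + y) * B + (1 - y) * A) / 2 + s) ^ (-3 : ℝ))) s :=
    fun s hs => hasDerivAt_propagators k (by positivity) (by positivity)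
  refine ⟨(hd 0 le_rfl).continuousAt.continuousWithinAt, fun s hs => (hd s hs.le).differentiableAt,
    fun s hs => ?_, ?_⟩
  · rw [(hd s hs.le).deriv, neg_nonpos]
    refine mul_nonneg hk (intervalIntegral.integral_nonneg (by norm_num) fun y hy => ?_)
    have h1 := mul_nonneg (by linarith [hy.1] : 0 ≤ 1 + y) hB.le
    have h2 := mul_nonneg (by linarith [hy.2] : 0 ≤ 1 - y) hA.le
    exact Real.rpow_nonneg (by linarith) _
  · have hz : ∀ A : ℝ, Tendsto (fun s : ℝ => 1 / (A + s)) atTop (𝓝 0) := fun A =>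
      tendsto_const_nhds.div_atTop (tendsto_atTop_add_const_left _ A tendsto_id)
    simpa using ((hz A).const_mul k).mul (hz B)

/-- The bubble in integer dimension. -/
lemma lintegral_bubble {n : ℕ} {P : EuclideanSpace ℝ (Fin (n + 1))} (hP : P ≠ 0)
    (hD4 : ((n + 1 : ℕ) : ℝ) < 4) {m₁ m₂ : ℝ} (h₁ : 0 < m₁) (h₂ : 0 < m₂) :
    0 ≤ innerIntegral ((n + 1 : ℕ) : ℝ) ‖P‖ m₁ m₂ ∧
    ∫⁻ x : EuclideanSpace ℝ (Fin (n + 1)), ENNReal.ofReal (1 / (2 * Real.pi) ^ (n + 1) *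
        (1 / (‖x‖ ^ 2 + m₁ ^ 2)) * (1 / (‖x + P‖ ^ 2 + m₂ ^ 2))) =
      ENNReal.ofReal (innerIntegral ((n + 1 : ℕ) : ℝ) ‖P‖ m₁ m₂) := by
  have hM₁ := pow_pos h₁ 2
  have hM₂ := pow_pos h₂ 2
  have hdec : ∀ u : ℝ, DecreasesToZero fun s => 1 / (2 * Real.pi) ^ ((n + 1 : ℕ) : ℝ) *
      (1 / (u ^ 2 + s + m₁ ^ 2)) * (1 / ((u + ‖P‖) ^ 2 + s + m₂ ^ 2)) := fun u => by
    have hpi := Real.pi_pos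
    have h := decreasesToZero_propagators (k := 1 / (2 * Real.pi) ^ ((n + 1 : ℕ) : ℝ))
      (A := u ^ 2 + m₁ ^ 2) (B := (u + ‖P‖) ^ 2 + m₂ ^ 2)
      (by positivity) (by positivity) (by positivity)
    simp_rw [add_right_comm (u ^ 2), add_right_comm ((u + ‖P‖) ^ 2)] at h
    exact h
  have hmeas : Measurable (Function.uncurry fun u s : ℝ =>
      1 / (2 * Real.pi) ^ ((n + 1 : ℕ) : ℝ) * (1 / (u ^ 2 + s + m₁ ^ 2)) *
        (1 / ((u + ‖P‖) ^ 2 + s + m₂ ^ 2))) := by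
    unfold Function.uncurry
    fun_prop
  have h := lintegral_eq_dimIntegral hP hmeas (Eventually.of_forall hdec)
    (integrable_rpow_mul_deriv_propagators ‖P‖ _ (by positivity) hD4 hM₁ hM₂)
  rw [← innerIntegral] at h
  refine ⟨h.1, ?_⟩
  rw [← h.2]
  refine lintegral_congr fun x => ?_
  rw [norm_add_sq_of_axis hP, add_sub_cancel, Real.rpow_natCast]

/-- The bubble with masses `v ^ 2 + t` and `(v + q) ^ 2 + t`, by its parametric representation. -/
noncomputable def bubbleProfile (D m p q v t : ℝ) : ℝ :=
  1 / (2 * Real.pi) ^ m * (Real.Gamma (2 - D / 2) / (2 * (4 * Real.pi) ^ (D / 2)) *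
    ∫ y in (-1 : ℝ)..1, feynDen p ((v ^ 2 + t) ^ 2) (((v + q) ^ 2 + t) ^ 2) y ^ (-(2 - D / 2)))

/-- The purpose of the parametric formula: joint measurability in (v, t) can be read off from it,
while it agrees with the bubble wherever both masses are positive. -/
lemma measurable_bubbleProfile (D m p q : ℝ) :
    Measurable (Function.uncurry (bubbleProfile D m p q)) := by
  unfold Function.uncurry bubbleProfile
  simp only [intervalIntegral.integral_of_le (show (-1 : ℝ) ≤ 1 by norm_num)]
  refine Measurable.const_mul (Measurable.const_mul ?_ _) _
  refine StronglyMeasurable.measurable ?_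
  refine StronglyMeasurable.integral_prod_right' (f := fun z : (ℝ × ℝ) × ℝ =>
    feynDen p ((z.1.1 ^ 2 + z.1.2) ^ 2) (((z.1.1 + q) ^ 2 + z.1.2) ^ 2) z.2 ^ (-(2 - D / 2))) ?_
  refine Measurable.stronglyMeasurable ?_
  unfold feynDen
  fun_prop

lemma bubbleProfile_eq {D v t : ℝ} (m p q : ℝ) (hD : 0 < D) (hD4 : D < 4)
    (h₁ : 0 < v ^ 2 + t) (h₂ : 0 < (v + q) ^ 2 + t) :
    bubbleProfile D m p q v t =
      1 / (2 * Real.pi) ^ m * innerIntegral D p (v ^ 2 + t) ((v + q) ^ 2 + t) := by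
  rw [bubbleProfile, innerIntegral_eq p hD hD4 h₁ h₂]

lemma bubbleProfile_eventuallyEq {D v t : ℝ} (m p q : ℝ) (hD : 0 < D) (hD4 : D < 4)
    (h₁ : 0 < v ^ 2 + t) (h₂ : 0 < (v + q) ^ 2 + t) :
    bubbleProfile D m p q v =ᶠ[𝓝 t] fun t =>
      1 / (2 * Real.pi) ^ m * innerIntegral D p (v ^ 2 + t) ((v + q) ^ 2 + t) := by
  filter_upwards [lt_mem_nhds (show -v ^ 2 < t by linarith),
    lt_mem_nhds (show -(v + q) ^ 2 < t by linarith)] with s h1 h2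
  exact bubbleProfile_eq m p q hD hD4 (by linarith) (by linarith)

/-- The two exclusions keep both masses positive down to t = 0; they remove only a null set of v. -/
lemma decreasesToZero_bubbleProfile {D p q v : ℝ} (m : ℝ) (hD : 0 < D) (hD4 : D < 4)
    (hv : v ≠ 0) (hvq : v + q ≠ 0) : DecreasesToZero (bubbleProfile D m p q v) := by
  have hpi := Real.pi_pos
  have hG := Real.Gamma_pos_of_pos (show 0 < 2 - D / 2 by linarith)
  have hv2 : 0 < v ^ 2 := by positivity
  have hvq2 : 0 < (v + q) ^ 2 := by positivity
  have hd := fun t (ht : 0 ≤ t) => ((hasDerivAt_innerIntegral p q hD hD4 (v := v) (t := t)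
    (by positivity) (by positivity)).const_mul (1 / (2 * Real.pi) ^ m)).congr_of_eventuallyEq
    (bubbleProfile_eventuallyEq m p q hD hD4 (by positivity) (by positivity))
  refine ⟨(hd 0 le_rfl).continuousAt.continuousWithinAt, fun t ht => (hd t ht.le).differentiableAt,
    fun t ht => ?_, ?_⟩
  · rw [(hd t ht.le).deriv, mul_neg, neg_nonpos]
    refine mul_nonneg (by positivity) (mul_nonneg (by positivity)
      (intervalIntegral.integral_nonneg (by norm_num) fun y hy => ?_))
    have h1 := mul_nonneg (by linarith [hy.1] : 0 ≤ 1 + y) (by positivity : 0 ≤ (v + q) ^ 2 + t)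
    have h2 := mul_nonneg (by linarith [hy.2] : 0 ≤ 1 - y) (by positivity : 0 ≤ v ^ 2 + t)
    exact mul_nonneg (mul_nonneg (by linarith) (by linarith)) (Real.rpow_nonneg
      (feynDen_pos p (by positivity) (by positivity) hy).le _)
  · have hlim : Tendsto (fun t : ℝ =>
        ∫ y in (-1 : ℝ)..1, feynDen p ((v ^ 2 + t) ^ 2) (((v + q) ^ 2 + t) ^ 2) y ^ (-(2 - D / 2)))
        atTop (𝓝 0) := by
      -- Both squared masses are at least t² for t > 0, so the Feynman denominator is at least t² on
      -- an interval of length 2.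
      have hg : Tendsto (fun t : ℝ => (t ^ 2) ^ (-(2 - D / 2)) * |(1 : ℝ) - -1|) atTop (𝓝 0) := by
        simpa using ((tendsto_rpow_neg_atTop (show 0 < 2 - D / 2 by linarith)).comp
          (tendsto_pow_atTop (n := 2) (by norm_num))).mul_const |(1 : ℝ) - -1|
      refine squeeze_zero_norm' ?_ hg
      filter_upwards [eventually_gt_atTop 0] with t ht
      refine intervalIntegral.norm_integral_le_of_norm_le_const fun y hy => ?_
      rw [uIoc_of_le (by norm_num)] at hy
      have hy' := Ioc_subset_Icc_self hy
      have hpos := feynDen_pos p (M₁ := (v ^ 2 + t) ^ 2) (M₂ := ((v + q) ^ 2 + t) ^ 2)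
        (by positivity) (by positivity) hy'
      rw [Real.norm_of_nonneg (Real.rpow_nonneg hpos.le _)]
      refine Real.rpow_le_rpow_of_nonpos (by positivity) ?_ (by linarith)
      have e1 : t ^ 2 ≤ (v ^ 2 + t) ^ 2 := pow_le_pow_left₀ ht.le (by linarith) 2
      have e2 : t ^ 2 ≤ ((v + q) ^ 2 + t) ^ 2 := pow_le_pow_left₀ ht.le (by linarith) 2
      have h1 := mul_le_mul_of_nonneg_left e2 (by linarith [hy'.1] : 0 ≤ 1 + y)
      have h2 := mul_le_mul_of_nonneg_left e1 (by linarith [hy'.2] : 0 ≤ 1 - y)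
      have h3 : 0 ≤ (1 - y ^ 2) * p ^ 2 := mul_nonneg (by nlinarith [hy'.1, hy'.2]) (sq_nonneg p)
      unfold feynDen
      linarith
    have := (hlim.const_mul (Real.Gamma (2 - D / 2) / (2 * (4 * Real.pi) ^ (D / 2)))).const_mul
      (1 / (2 * Real.pi) ^ m)
    rw [mul_zero, mul_zero] at this
    exact this

/-- Up to a constant this is the y-integral of the parametric integrand, translated back by q/2. -/
lemma integrable_rpow_mul_deriv_bubbleProfile {D m p q : ℝ} (hD : 0 < D) (hm : 0 < m)
    (hD4 : D < 4) (ha : 0 < parA D m) (ha2 : parA D m < 2) (hp : 0 < p) (hq : 0 < q) :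
    Integrable (fun z : ℝ × ℝ => z.2 ^ ((m - 1) / 2) * deriv (bubbleProfile D m p q z.1) z.2)
      (volume.prod (volume.restrict (Ioi 0))) := by
  have hmp : MeasurePreserving (Prod.map (fun v : ℝ => v + q / 2) id)
      (volume.prod (volume.restrict (Ioi (0 : ℝ)))) (volume.prod (volume.restrict (Ioi 0))) :=
    (measurePreserving_add_right volume (q / 2)).prod (MeasurePreserving.id _)
  have h := hmp.integrable_comp_of_integrable
    (integrable_momentKernel_mul hm hD4 ha ha2 hp hq).integral_prod_left
  refine (h.const_mul (-(1 / (2 * Real.pi) ^ m *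
    (Real.Gamma (2 - D / 2) / (2 * (4 * Real.pi) ^ (D / 2)))))).congr ?_
  filter_upwards [ae_snd_pos] with z hz
  have hk := fun y (hy : y ∈ uIcc (-1 : ℝ) 1) => feynDen_kernel (D := D) (m := m) (p := p)
    (v := z.1 + q / 2) hp hq hz (by rwa [uIcc_of_le (by norm_num)] at hy)
  rw [(bubbleProfile_eventuallyEq m p q hD hD4 (v := z.1) (t := z.2) (by positivity)
    (by positivity)).deriv_eq, feynman_section hD hD4 z.1 hz]
  simp only [Function.comp, Prod.map, id]
  rw [← intervalIntegral.integral_of_le (by norm_num), ← intervalIntegral.integral_congr hk,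
    intervalIntegral.integral_const_mul, add_sub_cancel_right]
  ring

lemma feynman_eq_dimIntegral_bubbleProfile {D : ℝ} (m p q : ℝ) (hD : 0 < D) (hD4 : D < 4) :
    feynman D m p q = dimIntegral m (bubbleProfile D m p q) := by
  unfold feynman dimIntegral
  refine integral_congr_ae (Eventually.of_forall fun v => ?_)
  beta_reduce
  congr 1
  refine setIntegral_congr_fun measurableSet_Ioi fun t ht => ?_
  have ht' : 0 < t := ht
  rw [(bubbleProfile_eventuallyEq m p q hD hD4 (v := v) (t := t) (by positivity)
    (by positivity)).deriv_eq]

/-- In integer dimensions the Feynman integral is the Lebesgue integral. -/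
lemma integrable_feynmanIntegrand {D m : ℕ} (hD : 0 < D) (hm : 0 < m)
    (hD4 : (D : ℝ) < 4) (ha : 0 < parA D m) (ha2 : parA D m < 2)
    {P : EuclideanSpace ℝ (Fin D)} {Q : EuclideanSpace ℝ (Fin m)} (hP : P ≠ 0) (hQ : Q ≠ 0) :
    Integrable (Function.uncurry (feynmanIntegrand P Q)) ∧
      feynman D m ‖P‖ ‖Q‖ = ∫ q', ∫ p', feynmanIntegrand P Q q' p' := by
  obtain ⟨n, rfl⟩ := Nat.exists_eq_add_one.2 hD
  obtain ⟨l, rfl⟩ := Nat.exists_eq_add_one.2 hm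
  have hD' : 0 < ((n + 1 : ℕ) : ℝ) := by positivity
  have hm' : 0 < ((l + 1 : ℕ) : ℝ) := by positivity
  have hp := norm_pos_iff.2 hP
  have hq := norm_pos_iff.2 hQ
  obtain ⟨h0, h⟩ := lintegral_eq_dimIntegral hQ
    (measurable_bubbleProfile ((n + 1 : ℕ) : ℝ) ((l + 1 : ℕ) : ℝ) ‖P‖ ‖Q‖)
    (by
      filter_upwards [Measure.ae_ne volume (0 : ℝ), Measure.ae_ne volume (-‖Q‖)] with v hv hvq
      exact decreasesToZero_bubbleProfile _ hD' hD4 hv fun h => hvq (by linarith))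
    (integrable_rpow_mul_deriv_bubbleProfile hD' hm' hD4 ha ha2 hp hq)
  rw [← feynman_eq_dimIntegral_bubbleProfile _ _ _ hD' hD4] at h0 h
  have hmeas : Measurable (Function.uncurry (feynmanIntegrand P Q)) := by
    unfold Function.uncurry feynmanIntegrand
    fun_prop
  have hnn : ∀ z, 0 ≤ Function.uncurry (feynmanIntegrand P Q) z := fun z => by
    have := Real.pi_pos
    unfold Function.uncurry feynmanIntegrand
    positivity
  have hlint : ∫⁻ z, ENNReal.ofReal (Function.uncurry (feynmanIntegrand P Q) z) =
      ENNReal.ofReal (feynman ((n + 1 : ℕ) : ℝ) ((l + 1 : ℕ) : ℝ) ‖P‖ ‖Q‖) := by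
    rw [← h, Measure.volume_eq_prod, lintegral_prod _ hmeas.ennreal_ofReal.aemeasurable]
    refine lintegral_congr_ae ?_
    -- A mass of the bubble vanishes only at the two excluded points.
    filter_upwards [Measure.ae_ne volume 0, Measure.ae_ne volume (-Q)] with x hx hxQ
    have hx1 : 0 < ‖x‖ ^ 2 := pow_pos (norm_pos_iff.2 hx) 2
    have hx2 : 0 < ‖x + Q‖ ^ 2 :=
      pow_pos (norm_pos_iff.2 fun h => hxQ (eq_neg_of_add_eq_zero_left h)) 2
    have e1 := norm_add_sq_of_axis hQ x
    have e2 := add_sub_cancel ((inner ℝ Q x / ‖Q‖) ^ 2) (‖x‖ ^ 2)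
    rw [bubbleProfile_eq _ _ _ hD' hD4 (by rwa [e2]) (by rwa [e1]), e1, e2,
      ENNReal.ofReal_mul (by have := Real.pi_pos; positivity),
      ← (lintegral_bubble hP hD4 hx1 hx2).2, ← lintegral_const_mul' _ _ ENNReal.ofReal_ne_top]
    refine lintegral_congr fun y => ?_
    rw [← ENNReal.ofReal_mul (by have := Real.pi_pos; positivity), Real.rpow_natCast]
    congr 1
    simp only [Function.uncurry, feynmanIntegrand]
    ring
  have hint : Integrable (Function.uncurry (feynmanIntegrand P Q)) := by
    refine ⟨hmeas.aestronglyMeasurable, ?_⟩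
    rw [hasFiniteIntegral_iff_ofReal (Eventually.of_forall hnn), hlint]
    exact ENNReal.ofReal_lt_top
  refine ⟨hint, ?_⟩
  refine Eq.trans ?_ (integral_prod _ hint)
  rw [integral_eq_lintegral_of_nonneg_ae (Eventually.of_forall hnn) hmeas.aestronglyMeasurable]
  exact (ENNReal.toReal_ofReal h0).symm.trans (congrArg ENNReal.toReal hlint.symm)

end Lifshitz

theorem theorem7 (D m : ℝ) (hD : 0 < D) (hm : 0 < m) (hlower : 2 + m / 2 < D + m)
    (hupper : D + m < 4 + m / 2) (p q : ℝ) (hp : 0 < p) (hq : 0 < q) :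
    -- the unit-argument hypergeometric series defining the coefficients `F_r` converge
    (∀ r : ℕ, Summable (Lifshitz.hyp32Term (Lifshitz.parA D m + 2 * r) (1 / 2) (Lifshitz.parB D)
      (3 / 2 + r) (Lifshitz.parB D + 1 + r) 1)) ∧
    -- the expansion converges, and its sum is `I_{D,m}(p,q)`
    Summable (fun k : ℕ => Lifshitz.poch (Lifshitz.parA D m / 2) k / (k.factorial : ℝ) *
      Lifshitz.upsilon D m k * Lifshitz.zeta p q ^ k) ∧
    Lifshitz.feynman D m p q =
      Lifshitz.coeffA D m * q ^ (-4 + 2 * Lifshitz.eps D m) /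
          (1 + Lifshitz.parX p q) ^ (Lifshitz.parA D m / 2) *
        ∑' k : ℕ, Lifshitz.poch (Lifshitz.parA D m / 2) k / (k.factorial : ℝ) *
          Lifshitz.upsilon D m k * Lifshitz.zeta p q ^ k ∧
    -- for integer dimensions `I_{D,m}(p,q)` is the (convergent) Lebesgue integral
    (∀ (D₀ m₀ : ℕ), D = D₀ → m = m₀ →
      ∀ (P : EuclideanSpace ℝ (Fin D₀)) (Q : EuclideanSpace ℝ (Fin m₀)), ‖P‖ = p → ‖Q‖ = q →
        MeasureTheory.Integrable (Function.uncurry (Lifshitz.feynmanIntegrand P Q)) ∧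
        Lifshitz.feynman D m p q = ∫ q', ∫ p', Lifshitz.feynmanIntegrand P Q q' p') := by
  -- The upper bound on D + m gives D < 4 and a > 0, the lower one a < 2; D < 4 gives b + 1 > 1/2.
  -- The parametric excess of every F_r is 2 - a, so a < 2 is its convergence condition.
  have hD4 : D < 4 := by linarith
  have ha : 0 < Lifshitz.parA D m := by unfold Lifshitz.parA; linarith
  have ha2 : Lifshitz.parA D m < 2 := by unfold Lifshitz.parA; linarith
  have hb : 0 < Lifshitz.parB D + 1 := by unfold Lifshitz.parB; linarith
  obtain ⟨hs, hf⟩ := Lifshitz.feynman_hasSum hD hm hD4 ha ha2 hp hq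
  refine ⟨fun r => ?_, hs, hf, ?_⟩
  · exact Lifshitz.hyp32Term_one_summable (by positivity) (by norm_num) hb (by positivity)
      (by positivity) (by linarith)
  · rintro D₀ m₀ rfl rfl P Q rfl rfl
    exact Lifshitz.integrable_feynmanIntegrand (by exact_mod_cast hD) (by exact_mod_cast hm) hD4 ha
      ha2 (norm_pos_iff.1 hp) (norm_pos_iff.1 hq)
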